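/- Let $a<a_1<b_1<b$, $\Omega=(a,b)$, $\Omega_1=(a_1,b_1)$, $\Omega_2=(a,a_1)\cup(b_1,b)$. Let $\alpha,\beta,\gamma>0$ and $\kappa\ge 0$ be constants, $h,q\in L^2(\Omega)$ and $g\in H^1(\Omega)$. Let $r$ be the signed distance to $\partial\Omega_1=\{a_1,b_1\}$, positive in $\Omega_1$ and negative outside $\overline{\Omega_1}$, and for $\varepsilon\in(0,1)$ put $$\phi_\varepsilon=\tfrac12\bigl[1+\tanh(r/\varepsilon)\bigr],\quad D_\varepsilon=\alpha+(1-\alpha)\phi_\varepsilon,\quad c_\varepsilon=\beta+(\gamma-\beta)\phi_\varepsilon,\quad f_\varepsilon=h+(q-h)\phi_\varepsilon,$$ $$D_0=\chi_{\Omega_1}+\alpha\chi_{\Omega_2},\quad c_0=\gamma\chi_{\Omega_1}+\beta\chi_{\Omega_2},\quad f_0=q\chi_{\Omega_1}+h\chi_{\Omega_2}.$$ Define $\mathcal F_\varepsilon,\mathcal F_0:L^2(\Omega)\to\mathbb R\cup\{+\infty\}$ by $\mathcal F_\varepsilon[u]=\mathcal F_0[u]=+\infty$ for $u\in L^2(\Omega)\setminus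 H^1(\Omega)$ and, for $u\in H^1(\Omega)$, $$\mathcal F_\varepsilon[u]=\int_\Omega\Bigl[\tfrac12\bigl(D_\varepsilon|u'|^2+c_\varepsilon u^2\bigr)-f_\varepsilon u+\bigl(\tfrac12\kappa u^2+gu\bigr)|\phi_\varepsilon'|\Bigr]dx,$$ $$\mathcal F_0[u]=\int_\Omega\Bigl[\tfrac12\bigl(D_0|u'|^2+c_0u^2\bigr)-f_0u\Bigr]dx+\sum_{x\in\{a_1,b_1\}}\bigl(\tfrac12\kappa u(x)^2+g(x)u(x)\bigr),$$ where the point values are those of the continuous representatives of $u$ and $g$. Let $(\varepsilon_k)\subset(0,1)$ be any sequence with $\varepsilon_k\to0$. Then: 1. (Compactness) If $u_k\in L^2(\Omega)$ and $\mathcal F_{\varepsilon_k}[u_k]<M$ for all $k$, with $M<\infty$ independent of $k$, then there are a subsequence $(u_{k_j})$ and $u\in H^1(\Omega)$ such that $u_{k_j}\to u$ strongly in $L^2(\Omega)$, weakly in $H^1(\Omega)$, and almost everywhere in $\Omega$. 2. ($\Gamma$-convergence of $\mathcal F_\varepsilon$ to $\mathcal F_0$ in the strong $L^2(\Omega)$-topology)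 For all $u\in L^2(\Omega)$ and all $u_k\to u$ in $L^2(\Omega)$, $\liminf_{k\to\infty}\mathcal F_{\varepsilon_k}[u_k]\ge\mathcal F_0[u]$; and for every $u\in L^2(\Omega)$ there is a sequence $u_k\to u$ in $L^2(\Omega)$ with $\limsup_{k\to\infty}\mathcal F_{\varepsilon_k}[u_k]\le\mathcal F_0[u]$. -/

import Mathlib

open Set Filter Topology MeasureTheory
open scoped ContDiff

noncomputable section

namespace DiffuseDomain

/-- The Lebesgue space `L²(a, b)`. -/
abbrev L2 (a b : ℝ) : Type := Lp ℝ 2 (volume.restrict (Ioo a b))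

/-- Test functions: smooth functions with compact support contained in `(a, b)`. -/
def IsTestFunction (a b : ℝ) (ψ : ℝ → ℝ) : Prop :=
  ContDiff ℝ ∞ ψ ∧ HasCompactSupport ψ ∧ tsupport ψ ⊆ Ioo a b

/-- `v` is the weak (distributional) derivative of `u` on `(a, b)`. -/
def IsWeakDeriv (a b : ℝ) (u v : ℝ → ℝ) : Prop :=
  ∀ ψ : ℝ → ℝ, IsTestFunction a b ψ →
    ∫ x in Ioo a b, u x * deriv ψ x = - ∫ x in Ioo a b, v x * ψ x

theorem integrable_mul_of_hasCompactSupport {a b : ℝ} (u : L2 a b) {ψ : ℝ → ℝ}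
    (hc : Continuous ψ) (hs : HasCompactSupport ψ) :
    Integrable (fun x => u x * ψ x) (volume.restrict (Ioo a b)) :=
  (Lp.memLp u).integrable_mul (q := 2) (hc.memLp_of_hasCompactSupport hs)

theorem IsTestFunction.integrable_mul {a b : ℝ} (u : L2 a b) {ψ : ℝ → ℝ}
    (hψ : IsTestFunction a b ψ) :
    Integrable (fun x => u x * ψ x) (volume.restrict (Ioo a b)) :=
  integrable_mul_of_hasCompactSupport u hψ.1.continuous hψ.2.1

theorem IsTestFunction.integrable_mul_deriv {a b : ℝ} (u : L2 a b) {ψ : ℝ → ℝ}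
    (hψ : IsTestFunction a b ψ) :
    Integrable (fun x => u x * deriv ψ x) (volume.restrict (Ioo a b)) :=
  integrable_mul_of_hasCompactSupport u (hψ.1.continuous_deriv (by simp)) hψ.2.1.deriv

/-- The Sobolev space `H¹(a, b)`, as the subspace of `L² × L²` of all pairs `(u, u')` where
`u'` is the weak derivative of `u`. Its norm, inherited from the `ℓ²` product, is
`(‖u‖² + ‖u'‖²)^(1/2)`. -/
def sobolevH1 (a b : ℝ) : Submodule ℝ (WithLp 2 (L2 a b × L2 a b)) where
  carrier := {w | IsWeakDeriv a b w.fst w.snd}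
  zero_mem' := by
    intro ψ _
    have h0 : ((0 : L2 a b) : ℝ → ℝ) =ᵐ[volume.restrict (Ioo a b)] 0 := Lp.coeFn_zero _ _ _
    have e1 : ∫ x in Ioo a b, (0 : L2 a b) x * deriv ψ x = 0 :=
      integral_eq_zero_of_ae (h0.mono fun x hx => by
        simp only [hx, Pi.zero_apply, zero_mul])
    have e2 : ∫ x in Ioo a b, (0 : L2 a b) x * ψ x = 0 :=
      integral_eq_zero_of_ae (h0.mono fun x hx => by
        simp only [hx, Pi.zero_apply, zero_mul])
    change ∫ x in Ioo a b, (0 : L2 a b) x * deriv ψ x =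
      - ∫ x in Ioo a b, (0 : L2 a b) x * ψ x
    rw [e1, e2, neg_zero]
  add_mem' := by
    intro w z hw hz ψ hψ
    have e1 : ∫ x in Ioo a b, (w.fst + z.fst) x * deriv ψ x =
        ∫ x in Ioo a b, (w.fst x * deriv ψ x + z.fst x * deriv ψ x) :=
      integral_congr_ae ((Lp.coeFn_add w.fst z.fst).mono fun x hx => by
        simp only [hx, Pi.add_apply, add_mul])
    have e2 : ∫ x in Ioo a b, (w.snd + z.snd) x * ψ x =
        ∫ x in Ioo a b, (w.snd x * ψ x + z.snd x * ψ x) :=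
      integral_congr_ae ((Lp.coeFn_add w.snd z.snd).mono fun x hx => by
        simp only [hx, Pi.add_apply, add_mul])
    change ∫ x in Ioo a b, (w.fst + z.fst) x * deriv ψ x =
      - ∫ x in Ioo a b, (w.snd + z.snd) x * ψ x
    rw [e1, e2, integral_add (hψ.integrable_mul_deriv _) (hψ.integrable_mul_deriv _),
      integral_add (hψ.integrable_mul _) (hψ.integrable_mul _), hw ψ hψ, hz ψ hψ]
    ring
  smul_mem' := by
    intro c w hw ψ hψ
    have e1 : ∫ x in Ioo a b, (c • w.fst) x * deriv ψ x =
        ∫ x in Ioo a b, c * (w.fst x * deriv ψ x) :=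
      integral_congr_ae ((Lp.coeFn_smul c w.fst).mono fun x hx => by
        simp only [hx, Pi.smul_apply, smul_eq_mul, mul_assoc])
    have e2 : ∫ x in Ioo a b, (c • w.snd) x * ψ x =
        ∫ x in Ioo a b, c * (w.snd x * ψ x) :=
      integral_congr_ae ((Lp.coeFn_smul c w.snd).mono fun x hx => by
        simp only [hx, Pi.smul_apply, smul_eq_mul, mul_assoc])
    change ∫ x in Ioo a b, (c • w.fst) x * deriv ψ x = - ∫ x in Ioo a b, (c • w.snd) x * ψ x
    rw [e1, e2, integral_const_mul, integral_const_mul, hw ψ hψ]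
    ring

/-- The type of elements of `H¹(a, b)`, a normed space. -/
abbrev H1 (a b : ℝ) : Type := sobolevH1 a b

/-- The `L²` function underlying an element of `H¹(a, b)`. -/
def H1.toL2 {a b : ℝ} (w : H1 a b) : L2 a b := w.1.fst

/-- The weak derivative of an element of `H¹(a, b)`. -/
def H1.grad {a b : ℝ} (w : H1 a b) : L2 a b := w.1.snd

open Classical in
/-- The pointwise value at an interior point of an `L²` class that has a continuous
representative on `(a, b)` (as every element of `H¹(a, b)` has); two such representatives
agree on `(a, b)`. -/
def pointValue {a b : ℝ} (u : L2 a b) (x : ℝ) : ℝ :=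
  if h : ∃ f : ℝ → ℝ, ContinuousOn f (Ioo a b) ∧ u =ᵐ[volume.restrict (Ioo a b)] f
  then h.choose x else 0

open Classical in
/-- The signed distance to the boundary of `(a₁, b₁)`, positive inside the interval. -/
def signedDistance (a₁ b₁ x : ℝ) : ℝ :=
  if x ∈ Ioo a₁ b₁ then Metric.infDist x (frontier (Ioo a₁ b₁))
  else - Metric.infDist x (frontier (Ioo a₁ b₁))

/-- The phase-field function `φ_ε`. -/
def phaseField (a₁ b₁ ε x : ℝ) : ℝ :=
  1 / 2 * (1 + Real.tanh (signedDistance a₁ b₁ x / ε))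

/-- The diffuse coefficient `s + (t - s) φ_ε`. -/
def diffuse (a₁ b₁ ε : ℝ) (s t : ℝ → ℝ) (x : ℝ) : ℝ :=
  s x + (t x - s x) * phaseField a₁ b₁ ε x

/-- The sharp coefficient `t χ_{Ω₁} + s χ_{Ω₂}`, where `Ω₁ = (a₁, b₁)` and
`Ω₂ = (a, a₁) ∪ (b₁, b)`. -/
def sharp (a a₁ b₁ b : ℝ) (s t : ℝ → ℝ) (x : ℝ) : ℝ :=
  (Ioo a₁ b₁).indicator t x + (Ioo a a₁ ∪ Ioo b₁ b).indicator s x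

/-- The diffuse energy `E_ε` on `H¹(a, b)`:
`∫ ½ (D_ε |u'|² + c_ε u²) - f_ε u + (½ κ u² + g u) |φ_ε'|`. -/
def diffuseEnergy {a b : ℝ} (a₁ b₁ α β γ κ : ℝ) (h q : L2 a b) (g : H1 a b) (ε : ℝ)
    (u : H1 a b) : ℝ :=
  ∫ x in Ioo a b,
    (1 / 2 * (diffuse a₁ b₁ ε (fun _ => α) (fun _ => 1) x * u.grad x ^ 2
        + diffuse a₁ b₁ ε (fun _ => β) (fun _ => γ) x * u.toL2 x ^ 2)
      - diffuse a₁ b₁ ε h q x * u.toL2 x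
      + (1 / 2 * κ * u.toL2 x ^ 2 + g.toL2 x * u.toL2 x) * |deriv (phaseField a₁ b₁ ε) x|)

/-- The sharp energy `E_0` on `H¹(a, b)`. The boundary integral over `∂Ω₁ = {a₁, b₁}` is the sum
of the point values of the integrand at the two endpoints. -/
def sharpEnergy {a b : ℝ} (a₁ b₁ α β γ κ : ℝ) (h q : L2 a b) (g : H1 a b)
    (u : H1 a b) : ℝ :=
  (∫ x in Ioo a b,
    (1 / 2 * (sharp a a₁ b₁ b (fun _ => α) (fun _ => 1) x * u.grad x ^ 2
        + sharp a a₁ b₁ b (fun _ => β) (fun _ => γ) x * u.toL2 x ^ 2)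
      - sharp a a₁ b₁ b h q x * u.toL2 x))
  + (1 / 2 * κ * pointValue u.toL2 a₁ ^ 2 + pointValue g.toL2 a₁ * pointValue u.toL2 a₁)
  + (1 / 2 * κ * pointValue u.toL2 b₁ ^ 2 + pointValue g.toL2 b₁ * pointValue u.toL2 b₁)

open Classical in
/-- The extension by `+∞` to `L²(a, b)` of a functional on `H¹(a, b)`. (The element of `H¹` over
a given `L²` function is unique, as weak derivatives are.) -/
def extendTop {a b : ℝ} (E : H1 a b → ℝ) (u : L2 a b) : EReal :=
  if h : ∃ w : H1 a b, w.toL2 = u then (E h.choose : EReal) else ⊤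

/-- Sequential Γ-convergence of `F ε`, `ε ∈ (0, 1)`, to `F₀` as `ε → 0`: along every sequence
`ε_k → 0`, the liminf inequality holds and recovery sequences exist. -/
def GammaConverges {X : Type*} [TopologicalSpace X] (F : ℝ → X → EReal) (F₀ : X → EReal) : Prop :=
  ∀ ε : ℕ → ℝ, (∀ k, ε k ∈ Ioo (0 : ℝ) 1) → Tendsto ε atTop (𝓝 0) →
    (∀ (u : X) (U : ℕ → X), Tendsto U atTop (𝓝 u) →
      F₀ u ≤ liminf (fun k => F (ε k) (U k)) atTop) ∧
    (∀ u : X, ∃ U : ℕ → X, Tendsto U atTop (𝓝 u) ∧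
      limsup (fun k => F (ε k) (U k)) atTop ≤ F₀ u)

/-- Compactness: along every sequence `ε_k → 0`, a sequence of bounded energy has a subsequence
that lies in `H¹` and converges to some `w ∈ H¹`, strongly in `L²`, weakly in `H¹` and
almost everywhere. -/
def EnergyCompact {a b : ℝ} (F : ℝ → L2 a b → EReal) : Prop :=
  ∀ ε : ℕ → ℝ, (∀ k, ε k ∈ Ioo (0 : ℝ) 1) → Tendsto ε atTop (𝓝 0) →
    ∀ (U : ℕ → L2 a b) (M : ℝ), (∀ k, F (ε k) (U k) < (M : EReal)) →
      ∃ (σ : ℕ → ℕ) (W : ℕ → H1 a b) (w : H1 a b),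
        StrictMono σ ∧ (∀ j, (W j).toL2 = U (σ j)) ∧
        Tendsto (fun j => U (σ j)) atTop (𝓝 w.toL2) ∧
        (∀ l : H1 a b →L[ℝ] ℝ, Tendsto (fun j => l (W j)) atTop (𝓝 (l w))) ∧
        (∀ᵐ x ∂(volume.restrict (Ioo a b)),
          Tendsto (fun j => U (σ j) x) atTop (𝓝 (w.toL2 x)))

end DiffuseDomain

end

/-!
The layer density `|φ_ε'|` has total mass at most `2` and `H¹(a, b)` embeds into the continuous
functions, so the diffuse energies are coercive on `H¹` uniformly in `ε`. Bounded energy therefore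
gives a bounded sequence in `H¹` and a weakly convergent subsequence, and since sequences bounded in
`H¹` are uniformly Hölder continuous of exponent `1/2`, weak convergence entails convergence of the
point values. Along such a sequence all terms without derivatives of `u` converge; for the surface
term this is because on each side of the midpoint of `Ω₁` the density `|φ_ε'|` is a rescaled copy of
the derivative of the sigmoid function, concentrating at `a₁` or `b₁`. The gradient term is weakly
lower semicontinuous by convexity. Finally, the diffuse energies converge pointwise on `H¹` to the
sharp one, so constant sequences are recovery sequences.
-/

noncomputable section

namespace DiffuseDomain

/-! ### Weak convergence -/

section WeakConvergence

variable {E F H : Type*} [NormedAddCommGroup E] [NormedSpace ℝ E]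
  [NormedAddCommGroup F] [NormedSpace ℝ F] [NormedAddCommGroup H] [InnerProductSpace ℝ H]

/-- Weak convergence in a real normed space, tested against all bounded linear functionals. -/
def TendstoWeakly {ι : Type*} (x : ι → E) (l : Filter ι) (x₀ : E) : Prop :=
  ∀ φ : E →L[ℝ] ℝ, Tendsto (fun i => φ (x i)) l (𝓝 (φ x₀))

theorem tendstoWeakly_const {ι : Type*} (x : E) (l : Filter ι) :
    TendstoWeakly (fun _ => x) l x :=
  fun _ => tendsto_const_nhds

theorem TendstoWeakly.map {ι : Type*} {x : ι → E} {l : Filter ι} {x₀ : E}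
    (hx : TendstoWeakly x l x₀) (T : E →L[ℝ] F) : TendstoWeakly (fun i => T (x i)) l (T x₀) :=
  fun φ => hx (φ.comp T)

theorem TendstoWeakly.exists_norm_le {x : ℕ → E} {x₀ : E} (hx : TendstoWeakly x atTop x₀) :
    ∃ B, ∀ k, ‖x k‖ ≤ B := by
  obtain ⟨B, hB⟩ := banach_steinhaus
    (g := fun k => NormedSpace.inclusionInDoubleDual ℝ E (x k)) fun φ => by
      obtain ⟨C, hC⟩ := (Metric.isBounded_range_of_tendsto _ (hx φ)).exists_norm_le
      exact ⟨C, fun k => hC _ (mem_range_self k)⟩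
  exact ⟨B, fun k => ((NormedSpace.inclusionInDoubleDualLi ℝ).norm_map (x k)).ge.trans (hB k)⟩

theorem TendstoWeakly.tendsto_inner {x y : ℕ → H} {x₀ y₀ : H} (hy : TendstoWeakly y atTop y₀)
    (hx : Tendsto x atTop (𝓝 x₀)) :
    Tendsto (fun k => inner ℝ (x k) (y k)) atTop (𝓝 (inner ℝ x₀ y₀)) := by
  obtain ⟨B, hB⟩ := hy.exists_norm_le
  have hdiff : Tendsto (fun k => inner ℝ (x k - x₀) (y k)) atTop (𝓝 0) := by
    have hbound := (tendsto_iff_norm_sub_tendsto_zero.1 hx).mul_const B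
    rw [zero_mul] at hbound
    exact squeeze_zero_norm (fun k => (norm_inner_le_norm _ _).trans
      (mul_le_mul_of_nonneg_left (hB k) (norm_nonneg _))) hbound
  simpa only [inner_sub_left, innerSL_apply_apply, sub_add_cancel, zero_add] using
    hdiff.add (hy (innerSL ℝ x₀))

theorem exists_subseq_tendstoWeakly [CompleteSpace H] [TopologicalSpace.SeparableSpace H]
    {x : ℕ → H} {B : ℝ} (hB : ∀ k, ‖x k‖ ≤ B) :
    ∃ (x₀ : H) (σ : ℕ → ℕ), StrictMono σ ∧ TendstoWeakly (fun j => x (σ j)) atTop x₀ := by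
  obtain ⟨φ, -, σ, hσ, hlim⟩ := WeakDual.isSeqCompact_closedBall ℝ H 0 B
    (x := fun k => StrongDual.toWeakDual (InnerProductSpace.toDual ℝ H (x k)))
    (fun k => by simpa using hB k)
  refine ⟨(InnerProductSpace.toDual ℝ H).symm (WeakDual.toStrongDual φ), σ, hσ, fun ψ => ?_⟩
  have riesz (z : H) : ψ z = inner ℝ z ((InnerProductSpace.toDual ℝ H).symm ψ) := by
    rw [real_inner_comm, InnerProductSpace.toDual_symm_apply]
  simp only [riesz, InnerProductSpace.toDual_symm_apply]
  exact ((WeakDual.eval_continuous _).tendsto φ).comp hlim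

end WeakConvergence

/-! ### Convergence of weighted quadratic forms in `L²` -/

section WeightedL2

variable {X : Type*} [MeasurableSpace X] {μ : Measure X}

theorem inner_eq_integral_mul (f g : Lp ℝ 2 μ) : inner ℝ f g = ∫ x, f x * g x ∂μ := by
  simp only [L2.inner_def, RCLike.inner_apply, conj_trivial, mul_comm]

theorem norm_sq_eq_integral_sq (f : Lp ℝ 2 μ) : ‖f‖ ^ 2 = ∫ x, f x ^ 2 ∂μ := by
  rw [← real_inner_self_eq_norm_sq, inner_eq_integral_mul]
  simp only [sq]

theorem tendsto_Lp_of_dominated {E : Type*} [NormedAddCommGroup E] {p : ENNReal} [Fact (1 ≤ p)]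
    (hp : p ≠ ⊤) {f : ℕ → Lp E p μ} {f₀ : Lp E p μ} {G : X → ℝ} (hG : MemLp G p μ)
    (hbound : ∀ k, ∀ᵐ x ∂μ, ‖f k x‖ ≤ G x)
    (hlim : ∀ᵐ x ∂μ, Tendsto (fun k => f k x) atTop (𝓝 (f₀ x))) :
    Tendsto f atTop (𝓝 f₀) := by
  have hp0 : p ≠ 0 := (zero_lt_one.trans_le Fact.out).ne'
  have hp' : 0 < p.toReal := ENNReal.toReal_pos hp0 hp
  have hbound₀ : ∀ᵐ x ∂μ, ‖f₀ x‖ ≤ G x := by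
    filter_upwards [ae_all_iff.2 hbound, hlim] with x hx hx₀
    exact le_of_tendsto hx₀.norm (Eventually.of_forall hx)
  have hint : Tendsto (fun k => ∫⁻ x, ‖(⇑(f k) - ⇑f₀) x‖ₑ ^ p.toReal ∂μ) atTop (𝓝 0) := by
    rw [← lintegral_zero (μ := μ)]
    refine tendsto_lintegral_of_dominated_convergence' (fun x => ‖(2 * G x : ℝ)‖ₑ ^ p.toReal)
      (fun k => (((Lp.aestronglyMeasurable _).sub (Lp.aestronglyMeasurable _)).enorm.pow_const _))
      (fun k => ?_)
      (lintegral_rpow_enorm_lt_top_of_eLpNorm_lt_top hp0 hp (hG.const_mul 2).eLpNorm_lt_top).ne ?_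
    · filter_upwards [hbound k, hbound₀] with x hx hx₀
      refine ENNReal.rpow_le_rpow (enorm_le_iff_norm_le.2 ?_) hp'.le
      refine (norm_sub_le _ _).trans (le_trans ?_ (le_abs_self _))
      linarith
    · filter_upwards [hlim] with x hx
      have hx' := (ENNReal.continuous_rpow_const (y := p.toReal)).tendsto _ |>.comp
        (hx.sub_const (f₀ x)).enorm
      simpa [Function.comp_def, hp'] using hx'
  rw [Lp.tendsto_Lp_iff_tendsto_eLpNorm']
  simp only [eLpNorm_eq_lintegral_rpow_enorm_toReal hp0 hp]
  have := (ENNReal.continuous_rpow_const (y := 1 / p.toReal)).tendsto _ |>.comp hint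
  simpa [Function.comp_def, hp'] using this

variable {c : ℕ → X → ℝ} {c₀ : X → ℝ} {C : ℝ} {y : ℕ → Lp ℝ 2 μ} {y₀ : Lp ℝ 2 μ}

theorem TendstoWeakly.tendsto_integral_mul (hy : TendstoWeakly y atTop y₀)
    (hc : ∀ k, AEStronglyMeasurable (c k) μ) (hC : ∀ k, ∀ᵐ x ∂μ, |c k x| ≤ C)
    (hlim : ∀ᵐ x ∂μ, Tendsto (fun k => c k x) atTop (𝓝 (c₀ x))) (z : Lp ℝ 2 μ) :
    Tendsto (fun k => ∫ x, c k x * (z x * y k x) ∂μ) atTop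
      (𝓝 (∫ x, c₀ x * (z x * y₀ x) ∂μ)) := by
  have hc₀ : AEStronglyMeasurable c₀ μ := aestronglyMeasurable_of_tendsto_ae atTop hc hlim
  have hC₀ : ∀ᵐ x ∂μ, |c₀ x| ≤ C := by
    filter_upwards [ae_all_iff.2 hC, hlim] with x hx hx₀
    exact le_of_tendsto hx₀.abs (Eventually.of_forall hx)
  have hcz (k) : MemLp (fun x => c k x * z x) 2 μ :=
    (Lp.memLp z).mul' (memLp_top_of_bound (hc k) C (hC k))
  have hcz₀ : MemLp (fun x => c₀ x * z x) 2 μ :=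
    (Lp.memLp z).mul' (memLp_top_of_bound hc₀ C hC₀)
  have strong : Tendsto (fun k => (hcz k).toLp) atTop (𝓝 hcz₀.toLp) := by
    refine tendsto_Lp_of_dominated (by simp) ((Lp.memLp z).norm.const_mul C) (fun k => ?_) ?_
    · filter_upwards [(hcz k).coeFn_toLp, hC k] with x hx hCx
      rw [hx, norm_mul]
      exact mul_le_mul_of_nonneg_right hCx (norm_nonneg _)
    · filter_upwards [ae_all_iff.2 fun k => (hcz k).coeFn_toLp, hcz₀.coeFn_toLp, hlim]
        with x hx hx₀ hcx
      simpa only [hx, hx₀] using hcx.mul_const (z x)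
  have hinner {f : X → ℝ} (hf : MemLp (fun x => f x * z x) 2 μ) (v : Lp ℝ 2 μ) :
      inner ℝ hf.toLp v = ∫ x, f x * (z x * v x) ∂μ := by
    rw [inner_eq_integral_mul]
    exact integral_congr_ae (hf.coeFn_toLp.mono fun x hx => by simp only [hx, mul_assoc])
  simpa only [hinner] using hy.tendsto_inner strong

theorem integrable_weight_mul {w : X → ℝ} (hw : AEStronglyMeasurable w μ)
    (hC : ∀ᵐ x ∂μ, |w x| ≤ C) (y z : Lp ℝ 2 μ) :
    Integrable (fun x => w x * (y x * z x)) μ :=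
  ((Lp.memLp y).integrable_mul (Lp.memLp z)).bdd_mul hw hC

/-- Weak lower semicontinuity comes from convexity: a square lies above its tangent, which is
linear in `y k`. -/
theorem TendstoWeakly.integral_mul_sq_le (hy : TendstoWeakly y atTop y₀)
    (hc : ∀ k, AEStronglyMeasurable (c k) μ) (hc0 : ∀ k, ∀ᵐ x ∂μ, 0 ≤ c k x)
    (hC : ∀ k, ∀ᵐ x ∂μ, |c k x| ≤ C)
    (hlim : ∀ᵐ x ∂μ, Tendsto (fun k => c k x) atTop (𝓝 (c₀ x))) {e : ℕ → ℝ} {e₀ : ℝ}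
    (he : Tendsto e atTop (𝓝 e₀)) (hle : ∀ᶠ k in atTop, ∫ x, c k x * y k x ^ 2 ∂μ ≤ e k) :
    ∫ x, c₀ x * y₀ x ^ 2 ∂μ ≤ e₀ := by
  have tangent_le (k) : 2 * ∫ x, c k x * (y₀ x * y k x) ∂μ - ∫ x, c k x * (y₀ x * y₀ x) ∂μ ≤
      ∫ x, c k x * y k x ^ 2 ∂μ := by
    have hint := integrable_weight_mul (hc k) (hC k)
    rw [← integral_const_mul, ← integral_sub ((hint y₀ (y k)).const_mul 2) (hint y₀ y₀)]
    simp only [sq]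
    refine integral_mono_ae (((hint y₀ (y k)).const_mul 2).sub (hint y₀ y₀)) (hint (y k) (y k)) ?_
    filter_upwards [hc0 k] with x hx
    nlinarith [mul_nonneg hx (sq_nonneg (y k x - y₀ x))]
  have tangent_lim :=
    ((hy.tendsto_integral_mul hc hC hlim y₀).const_mul 2).sub
      ((tendstoWeakly_const y₀ atTop).tendsto_integral_mul hc hC hlim y₀)
  have := le_of_tendsto_of_tendsto tangent_lim he
    (hle.mono fun k hk => (tangent_le k).trans hk)
  simp only [sq]
  linarith

end WeightedL2

/-! ### Functions with vanishing weak derivative -/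

section WeakDerivative

variable {a b : ℝ} {ψ : ℝ → ℝ}

theorem IsTestFunction.eq_zero (hψ : IsTestFunction a b ψ) {x : ℝ} (hx : x ∉ Ioo a b) : ψ x = 0 :=
  image_eq_zero_of_notMem_tsupport fun h => hx (hψ.2.2 h)

theorem IsTestFunction.deriv (hψ : IsTestFunction a b ψ) : IsTestFunction a b (deriv ψ) :=
  ⟨(contDiff_infty_iff_deriv.1 hψ.1).2, hψ.2.1.deriv, tsupport_deriv_subset.trans hψ.2.2⟩

theorem IsTestFunction.sub_const_mul (hψ : IsTestFunction a b ψ) (m : ℝ) {θ : ℝ → ℝ}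
    (hθ : IsTestFunction a b θ) : IsTestFunction a b fun x => ψ x - m * θ x :=
  ⟨hψ.1.sub (contDiff_const.mul hθ.1), hψ.2.1.sub hθ.2.1.mul_left,
    (tsupport_sub _ _).trans (union_subset hψ.2.2
      ((tsupport_mul_subset_right (f := fun _ => m)).trans hθ.2.2))⟩

theorem IsTestFunction.integrable_mul_of_integrable (hψ : IsTestFunction a b ψ) {z : ℝ → ℝ}
    {μ : Measure ℝ} (hz : Integrable z μ) : Integrable (fun x => z x * ψ x) μ := by
  obtain ⟨C, hC⟩ := hψ.1.continuous.bounded_above_of_compact_support hψ.2.1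
  exact hz.mul_bdd (c := C) hψ.1.continuous.aestronglyMeasurable (ae_of_all _ hC)

theorem IsTestFunction.exists_tsupport_subset_Icc (hab : a < b) (hψ : IsTestFunction a b ψ) :
    ∃ a' b', a < a' ∧ b' < b ∧ tsupport ψ ⊆ Icc a' b' := by
  have hcompact : IsCompact (tsupport ψ) := hψ.2.1
  rcases (tsupport ψ).eq_empty_or_nonempty with hempty | hne
  · exact ⟨b, a, hab, hab, by simp [hempty]⟩
  · obtain ⟨s, hs⟩ := hcompact.exists_isLeast hne
    obtain ⟨t, ht⟩ := hcompact.exists_isGreatest hne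
    exact ⟨s, t, (hψ.2.2 hs.1).1, (hψ.2.2 ht.1).2, fun x hx => ⟨hs.2 hx, ht.2 hx⟩⟩

theorem tsupport_primitive_subset_Icc {η : ℝ → ℝ} {a' b' : ℝ} (ha : a < a') (hb : b' < b)
    (hη : Continuous η) (hsupp : tsupport η ⊆ Icc a' b') (hmean : ∫ t in a..b, η t = 0) :
    tsupport (fun x => ∫ t in a..x, η t) ⊆ Icc a' b' := by
  have hzero (t : ℝ) (ht : t ∉ Icc a' b') : η t = 0 :=
    image_eq_zero_of_notMem_tsupport fun h => ht (hsupp h)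
  refine closure_minimal (fun x hx => ?_) isClosed_Icc
  contrapose! hx
  rw [Function.notMem_support]
  rcases lt_or_ge x a' with hxa | hxa
  · refine intervalIntegral.integral_zero_ae (ae_of_all _ fun t ht => hzero t fun h => ?_)
    exact h.1.not_gt (ht.2.trans_lt (max_lt ha hxa))
  · have hxb : b' < x := not_le.1 fun h => hx ⟨hxa, h⟩
    rw [← intervalIntegral.integral_add_adjacent_intervals (hη.intervalIntegrable a b)
      (hη.intervalIntegrable b x), hmean, zero_add]
    refine intervalIntegral.integral_zero_ae (ae_of_all _ fun t ht => hzero t fun h => ?_)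
    exact h.2.not_gt ((lt_min hb hxb).trans ht.1)

theorem IsTestFunction.exists_deriv_eq (hab : a < b) (hψ : IsTestFunction a b ψ)
    (hmean : ∫ x in Ioo a b, ψ x = 0) : ∃ Ψ, IsTestFunction a b Ψ ∧ _root_.deriv Ψ = ψ := by
  have hcont := hψ.1.continuous
  have hderivAt (x) : HasDerivAt (fun x => ∫ t in a..x, ψ t) (ψ x) x :=
    hcont.integral_hasStrictDerivAt a x |>.hasDerivAt
  have hderiv : _root_.deriv (fun x => ∫ t in a..x, ψ t) = ψ := funext fun x => (hderivAt x).deriv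
  rw [← integral_Ioc_eq_integral_Ioo, ← intervalIntegral.integral_of_le hab.le] at hmean
  obtain ⟨a', b', ha, hb, hsupp⟩ := hψ.exists_tsupport_subset_Icc hab
  have hsupp' := tsupport_primitive_subset_Icc ha hb hcont hsupp hmean
  refine ⟨fun x => ∫ t in a..x, ψ t, ⟨?_, ?_, hsupp'.trans (Icc_subset_Ioo ha hb)⟩, hderiv⟩
  · rw [contDiff_infty_iff_deriv, hderiv]
    exact ⟨fun x => (hderivAt x).differentiableAt, hψ.1⟩
  · exact isCompact_Icc.of_isClosed_subset (isClosed_tsupport _) hsupp'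

theorem exists_isTestFunction_integral_eq_one (hab : a < b) :
    ∃ θ, IsTestFunction a b θ ∧ ∫ x in Ioo a b, θ x = 1 := by
  let f : ContDiffBump ((a + b) / 2) :=
    ⟨(b - a) / 8, (b - a) / 4, by linarith, by linarith⟩
  have hsupp : tsupport (f.normed volume) ⊆ Ioo a b := by
    rw [f.tsupport_normed_eq, Real.closedBall_eq_Icc]
    refine Icc_subset_Ioo ?_ ?_ <;> simp only [f] <;> linarith
  have hθ : IsTestFunction a b (f.normed volume) :=
    ⟨f.contDiff_normed, f.hasCompactSupport_normed, hsupp⟩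
  refine ⟨f.normed volume, hθ, ?_⟩
  rw [setIntegral_eq_integral_of_forall_compl_eq_zero fun x hx => hθ.eq_zero hx]
  exact f.integral_normed

theorem ae_eq_zero_of_forall_isTestFunction {f : ℝ → ℝ} (hf : IntegrableOn f (Ioo a b))
    (h : ∀ ψ, IsTestFunction a b ψ → ∫ x in Ioo a b, f x * ψ x = 0) :
    f =ᵐ[volume.restrict (Ioo a b)] 0 := by
  refine (ae_restrict_iff' measurableSet_Ioo).2
    (isOpen_Ioo.ae_eq_zero_of_integral_contDiff_smul_eq_zero hf.locallyIntegrableOn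
      fun ψ hsmooth hcompact hsupp => ?_)
  have hψ : IsTestFunction a b ψ := ⟨hsmooth, hcompact, hsupp⟩
  rw [← h ψ hψ, setIntegral_eq_integral_of_forall_compl_eq_zero fun x hx => by
    rw [hψ.eq_zero hx, mul_zero]]
  simp only [smul_eq_mul, mul_comm]

/-- Subtracting from `ψ` a multiple of a fixed test function of integral one leaves a derivative of
a test function, so `f` acts on `ψ` as a constant does. -/
theorem ae_eq_const_of_forall_integral_mul_deriv_eq_zero (hab : a < b) {f : ℝ → ℝ}
    (hf : IntegrableOn f (Ioo a b))
    (h : ∀ ψ, IsTestFunction a b ψ → ∫ x in Ioo a b, f x * deriv ψ x = 0) :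
    ∃ c : ℝ, f =ᵐ[volume.restrict (Ioo a b)] fun _ => c := by
  obtain ⟨θ, hθ, hθ1⟩ := exists_isTestFunction_integral_eq_one hab
  refine ⟨∫ x in Ioo a b, f x * θ x, ?_⟩
  set c := ∫ x in Ioo a b, f x * θ x
  suffices (fun x => f x - c) =ᵐ[volume.restrict (Ioo a b)] 0 from
    this.mono fun x hx => sub_eq_zero.1 hx
  refine ae_eq_zero_of_forall_isTestFunction (hf.sub (integrable_const c)) fun ψ hψ => ?_
  have hintegrable {φ : ℝ → ℝ} (hφ : IsTestFunction a b φ) : IntegrableOn φ (Ioo a b) :=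
    (hφ.1.continuous.integrable_of_hasCompactSupport hφ.2.1).restrict
  set m := ∫ x in Ioo a b, ψ x
  obtain ⟨Ψ, hΨ, hΨ'⟩ := (hψ.sub_const_mul m hθ).exists_deriv_eq hab (by
    rw [integral_sub (hintegrable hψ) ((hintegrable hθ).const_mul m), integral_const_mul, hθ1,
      mul_one, sub_self])
  have hfΨ := h Ψ hΨ
  simp only [hΨ', mul_sub, mul_left_comm (f _) m] at hfΨ
  rw [integral_sub (hψ.integrable_mul_of_integrable hf)
    ((hθ.integrable_mul_of_integrable hf).const_mul m), integral_const_mul] at hfΨ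
  simp only [sub_mul]
  rw [integral_sub (hψ.integrable_mul_of_integrable hf) ((hintegrable hψ).const_mul c),
    integral_const_mul, ← hfΨ, mul_comm m]

end WeakDerivative

/-! ### The Sobolev space `H¹` of an interval -/

section Sobolev

variable {a b : ℝ}

theorem L2.integrable (v : L2 a b) : Integrable v (volume.restrict (Ioo a b)) :=
  (Lp.memLp v).integrable one_le_two

theorem L2.integrableOn_Icc (v : L2 a b) : IntegrableOn v (Icc a b) :=
  (integrableOn_Icc_iff_integrableOn_Ioo).2 v.integrable

theorem L2.intervalIntegrable (v : L2 a b) {x y : ℝ} (hx : x ∈ Icc a b) (hy : y ∈ Icc a b) :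
    IntervalIntegrable v volume x y :=
  (v.integrableOn_Icc.mono_set (uIcc_subset_Icc hx hy)).intervalIntegrable

theorem L2.abs_intervalIntegral_le (v : L2 a b) {x y : ℝ} (hx : x ∈ Icc a b) (hy : y ∈ Icc a b) :
    |∫ t in x..y, v t| ≤ √|y - x| * ‖v‖ := by
  wlog hxy : x ≤ y generalizing x y
  · rw [intervalIntegral.integral_symm, abs_neg, abs_sub_comm]
    exact this hy hx (le_of_not_ge hxy)
  have hsub : Ioo x y ⊆ Ioo a b := Ioo_subset_Ioo hx.1 hy.2
  have hmeas : (volume.restrict (Ioo a b)) (Ioo x y) = ENNReal.ofReal (y - x) := by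
    rw [Measure.restrict_apply measurableSet_Ioo, inter_eq_left.2 hsub, Real.volume_Ioo]
  have hfin : (volume.restrict (Ioo a b)) (Ioo x y) ≠ ⊤ := by simp [hmeas]
  have hinner : ∫ t in x..y, v t = inner ℝ (indicatorConstLp 2 measurableSet_Ioo hfin 1) v := by
    rw [MeasureTheory.L2.inner_indicatorConstLp_one (𝕜 := ℝ) measurableSet_Ioo hfin v,
      intervalIntegral.integral_of_le hxy,
      integral_Ioc_eq_integral_Ioo, Measure.restrict_restrict measurableSet_Ioo,
      inter_eq_left.2 hsub]
  have hnorm : ‖indicatorConstLp 2 measurableSet_Ioo hfin (1 : ℝ)‖ = √|y - x| := by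
    rw [norm_indicatorConstLp (by simp) (by simp), measureReal_def, hmeas,
      ENNReal.toReal_ofReal (sub_nonneg.2 hxy), abs_of_nonneg (sub_nonneg.2 hxy),
      Real.sqrt_eq_rpow, norm_one, one_mul, ENNReal.toReal_ofNat]
  rw [hinner, ← hnorm]
  exact norm_inner_le_norm (𝕜 := ℝ) _ _

theorem L2.continuousOn_primitive (hab : a ≤ b) (v : L2 a b) :
    ContinuousOn (fun x => ∫ t in a..x, v t) (Icc a b) := by
  have hv := v.integrableOn_Icc
  rw [← uIcc_of_le hab] at hv ⊢
  exact intervalIntegral.continuousOn_primitive_interval hv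

theorem L2.isWeakDeriv_primitive (hab : a < b) (v : L2 a b) :
    IsWeakDeriv a b (fun x => ∫ t in a..x, v t) v := by
  intro ψ hψ
  have hv := v.intervalIntegrable (left_mem_Icc.2 hab.le) (right_mem_Icc.2 hab.le)
  have hparts := (hv.absolutelyContinuousOnInterval_intervalIntegral (c := a)
    (by simp)).integral_mul_deriv_eq_deriv_mul
    ((hψ.1.of_le (by simp)).contDiffOn.absolutelyContinuousOnInterval (a := a) (b := b))
  have hderiv : ∫ x in a..b, deriv (fun x => ∫ t in a..x, v t) x * ψ x =
      ∫ x in a..b, v x * ψ x := by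
    refine intervalIntegral.integral_congr_ae ?_
    filter_upwards [hv.ae_hasDerivAt_integral] with x hx hx'
    rw [(hx (uIoc_subset_uIcc hx') a (by simp)).deriv]
  rw [hψ.eq_zero (x := a) (by simp), hψ.eq_zero (x := b) (by simp), hderiv] at hparts
  simpa only [mul_zero, sub_zero, zero_sub, intervalIntegral.integral_of_le hab.le,
    integral_Ioc_eq_integral_Ioo] using hparts

theorem H1.isWeakDeriv (w : H1 a b) : IsWeakDeriv a b w.toL2 w.grad := w.2

theorem H1.toL2_injective : Function.Injective (H1.toL2 : H1 a b → L2 a b) := by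
  intro w z hwz
  have hgrad : (fun x => w.grad x - z.grad x) =ᵐ[volume.restrict (Ioo a b)] 0 := by
    refine ae_eq_zero_of_forall_isTestFunction (w.grad.integrable.sub z.grad.integrable) ?_
    intro ψ hψ
    have hw := w.isWeakDeriv ψ hψ
    rw [hwz, z.isWeakDeriv ψ hψ, neg_inj] at hw
    simp only [sub_mul]
    rw [integral_sub (hψ.integrable_mul _) (hψ.integrable_mul _), hw, sub_self]
  exact Subtype.ext (WithLp.ofLp_injective 2
    (Prod.ext hwz (Lp.ext (hgrad.mono fun x hx => sub_eq_zero.1 hx))))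

theorem H1.exists_ae_eq_primitive (hab : a < b) (w : H1 a b) :
    ∃ c : ℝ, w.toL2 =ᵐ[volume.restrict (Ioo a b)] fun x => c + ∫ t in a..x, w.grad t := by
  have hprim : IntegrableOn (fun x => ∫ t in a..x, w.grad t) (Ioo a b) :=
    (w.grad.continuousOn_primitive hab.le).integrableOn_Icc.mono_set Ioo_subset_Icc_self
  obtain ⟨c, hc⟩ := ae_eq_const_of_forall_integral_mul_deriv_eq_zero hab
    (w.toL2.integrable.sub hprim) fun ψ hψ => by
      simp only [Pi.sub_apply, sub_mul]
      rw [integral_sub (hψ.integrable_mul_deriv _) (hψ.deriv.integrable_mul_of_integrable hprim),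
        w.isWeakDeriv ψ hψ, w.grad.isWeakDeriv_primitive hab ψ hψ, sub_self]
  exact ⟨c, hc.mono fun x hx => eq_add_of_sub_eq hx⟩

theorem continuous_integral_mul {η : ℝ → ℝ} (hη : MemLp η 2 (volume.restrict (Ioo a b))) :
    Continuous fun u : L2 a b => ∫ x in Ioo a b, u x * η x := by
  have hinner (u : L2 a b) : ∫ x in Ioo a b, u x * η x = inner ℝ u hη.toLp := by
    rw [inner_eq_integral_mul]
    exact integral_congr_ae (hη.coeFn_toLp.mono fun x hx => by simp only [hx])
  simp only [hinner]
  fun_prop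

theorem isClosed_sobolevH1 : IsClosed (sobolevH1 a b : Set (WithLp 2 (L2 a b × L2 a b))) := by
  have hinter : (sobolevH1 a b : Set (WithLp 2 (L2 a b × L2 a b))) =
      ⋂ (ψ : ℝ → ℝ) (_ : IsTestFunction a b ψ), {w | ∫ x in Ioo a b, w.fst x * deriv ψ x =
        - ∫ x in Ioo a b, w.snd x * ψ x} := by
    ext w
    simp only [mem_iInter, mem_ofPred_eq]
    rfl
  have memLp {ψ : ℝ → ℝ} (hψ : IsTestFunction a b ψ) : MemLp ψ 2 (volume.restrict (Ioo a b)) :=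
    hψ.1.continuous.memLp_of_hasCompactSupport hψ.2.1
  rw [hinter]
  refine isClosed_iInter fun ψ => isClosed_iInter fun hψ => isClosed_eq ?_ ?_
  · exact (continuous_integral_mul (memLp hψ.deriv)).comp
      (WithLp.fstL 2 ℝ (L2 a b) (L2 a b)).continuous
  · exact ((continuous_integral_mul (memLp hψ)).comp
      (WithLp.sndL 2 ℝ (L2 a b) (L2 a b)).continuous).neg

instance : CompleteSpace (H1 a b) := isClosed_sobolevH1.completeSpace_coe

instance : TopologicalSpace.SeparableSpace (H1 a b) := by
  have : Fact ((2 : ENNReal) ≠ ⊤) := ⟨by simp⟩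
  infer_instance

theorem H1.norm_sq_eq (w : H1 a b) : ‖w‖ ^ 2 = ‖w.toL2‖ ^ 2 + ‖w.grad‖ ^ 2 :=
  WithLp.prod_norm_sq_eq_of_L2 w.1

theorem H1.norm_toL2_le (w : H1 a b) : ‖w.toL2‖ ≤ ‖w‖ :=
  le_of_sq_le_sq (w.norm_sq_eq ▸ le_add_of_nonneg_right (sq_nonneg _)) (norm_nonneg _)

theorem H1.norm_grad_le (w : H1 a b) : ‖w.grad‖ ≤ ‖w‖ :=
  le_of_sq_le_sq (w.norm_sq_eq ▸ le_add_of_nonneg_left (sq_nonneg _)) (norm_nonneg _)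

/-- The weak derivative `H¹(a, b) → L²(a, b)` as a bounded operator, through which weak convergence
in `H¹` passes to the derivatives. -/
def H1.gradL : H1 a b →L[ℝ] L2 a b :=
  (WithLp.sndL 2 ℝ (L2 a b) (L2 a b)).comp (sobolevH1 a b).subtypeL

end Sobolev

/-! ### Point values of `H¹` functions -/

section PointValue

variable {a b : ℝ}

theorem H1.continuousOn_const_add_primitive (hab : a < b) (w : H1 a b) (c : ℝ) :
    ContinuousOn (fun x => c + ∫ t in a..x, w.grad t) (Ioo a b) :=
  continuousOn_const.add ((w.grad.continuousOn_primitive hab.le).mono Ioo_subset_Icc_self)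

theorem H1.pointValue_spec (hab : a < b) (w : H1 a b) :
    ContinuousOn (pointValue w.toL2) (Ioo a b) ∧
      w.toL2 =ᵐ[volume.restrict (Ioo a b)] pointValue w.toL2 := by
  have hrep : ∃ f : ℝ → ℝ, ContinuousOn f (Ioo a b) ∧ w.toL2 =ᵐ[volume.restrict (Ioo a b)] f := by
    obtain ⟨c, hc⟩ := w.exists_ae_eq_primitive hab
    exact ⟨_, w.continuousOn_const_add_primitive hab c, hc⟩
  have hchoose : pointValue w.toL2 = hrep.choose := funext fun x => dif_pos hrep
  exact hchoose ▸ hrep.choose_spec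

theorem H1.continuousOn_pointValue (hab : a < b) (w : H1 a b) :
    ContinuousOn (pointValue w.toL2) (Ioo a b) :=
  (w.pointValue_spec hab).1

theorem H1.ae_eq_pointValue (hab : a < b) (w : H1 a b) :
    w.toL2 =ᵐ[volume.restrict (Ioo a b)] pointValue w.toL2 :=
  (w.pointValue_spec hab).2

theorem H1.pointValue_eqOn (hab : a < b) (w : H1 a b) {f : ℝ → ℝ} (hf : ContinuousOn f (Ioo a b))
    (h : w.toL2 =ᵐ[volume.restrict (Ioo a b)] f) : EqOn (pointValue w.toL2) f (Ioo a b) :=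
  Measure.eqOn_open_of_ae_eq ((w.ae_eq_pointValue hab).symm.trans h) isOpen_Ioo
    (w.continuousOn_pointValue hab) hf

theorem H1.pointValue_add (hab : a < b) (w z : H1 a b) {x : ℝ} (hx : x ∈ Ioo a b) :
    pointValue (w + z).toL2 x = pointValue w.toL2 x + pointValue z.toL2 x := by
  refine (w + z).pointValue_eqOn hab (f := fun x => pointValue w.toL2 x + pointValue z.toL2 x)
    ((w.continuousOn_pointValue hab).add (z.continuousOn_pointValue hab)) ?_ hx
  filter_upwards [Lp.coeFn_add w.toL2 z.toL2, w.ae_eq_pointValue hab, z.ae_eq_pointValue hab]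
    with x hadd hw hz
  rw [← hw, ← hz]
  exact hadd

theorem H1.pointValue_smul (hab : a < b) (c : ℝ) (w : H1 a b) {x : ℝ} (hx : x ∈ Ioo a b) :
    pointValue (c • w).toL2 x = c * pointValue w.toL2 x := by
  refine (c • w).pointValue_eqOn hab (f := fun x => c * pointValue w.toL2 x)
    (continuousOn_const.mul (w.continuousOn_pointValue hab)) ?_ hx
  filter_upwards [Lp.coeFn_smul c w.toL2, w.ae_eq_pointValue hab] with x hsmul hw
  rw [← hw]
  exact hsmul

theorem H1.abs_pointValue_sub_le (hab : a < b) (w : H1 a b) {x y : ℝ} (hx : x ∈ Ioo a b)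
    (hy : y ∈ Ioo a b) :
    |pointValue w.toL2 y - pointValue w.toL2 x| ≤ √|y - x| * ‖w‖ := by
  obtain ⟨c, hc⟩ := w.exists_ae_eq_primitive hab
  have heq := w.pointValue_eqOn hab (w.continuousOn_const_add_primitive hab c) hc
  have ha : a ∈ Icc a b := left_mem_Icc.2 hab.le
  have hx' := Ioo_subset_Icc_self hx
  have hy' := Ioo_subset_Icc_self hy
  rw [heq hx, heq hy, add_sub_add_left_eq_sub, intervalIntegral.integral_interval_sub_left
    (w.grad.intervalIntegrable ha hy') (w.grad.intervalIntegrable ha hx')]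
  exact (w.grad.abs_intervalIntegral_le hx' hy').trans
    (mul_le_mul_of_nonneg_left w.norm_grad_le (Real.sqrt_nonneg _))

theorem H1.exists_abs_pointValue_le (hab : a < b) (w : H1 a b) :
    ∃ y ∈ Ioo a b, |pointValue w.toL2 y| ≤ (√(b - a))⁻¹ * ‖w‖ := by
  have hL : 0 < b - a := sub_pos.2 hab
  have hsq : (fun x => w.toL2 x ^ 2) =ᵐ[volume.restrict (Ioo a b)]
      fun x => pointValue w.toL2 x ^ 2 :=
    (w.ae_eq_pointValue hab).mono fun x hx => by simp only [hx]
  obtain ⟨y, hy, hle⟩ := exists_le_setAverage (μ := volume) (s := Ioo a b) (by simpa using hab)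
    (by simp) ((Lp.memLp w.toL2).integrable_sq.congr hsq)
  refine ⟨y, hy, abs_le_of_sq_le_sq ?_ (by positivity)⟩
  rw [setAverage_eq, ← integral_congr_ae hsq, ← norm_sq_eq_integral_sq,
    Real.volume_real_Ioo_of_le hab.le, smul_eq_mul] at hle
  rw [mul_pow, inv_pow, Real.sq_sqrt hL.le]
  exact hle.trans (mul_le_mul_of_nonneg_left
    (pow_le_pow_left₀ (norm_nonneg _) w.norm_toL2_le 2) (by positivity))

/-- A bound for the norm of the embedding of `H¹(a, b)` into continuous functions: the first summand
bounds some value of a function, the second its oscillation. -/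
def embeddingConst (a b : ℝ) : ℝ := (√(b - a))⁻¹ + √(b - a)

theorem embeddingConst_nonneg : 0 ≤ embeddingConst a b := by
  unfold embeddingConst
  positivity

theorem H1.abs_pointValue_le (hab : a < b) (w : H1 a b) {x : ℝ} (hx : x ∈ Ioo a b) :
    |pointValue w.toL2 x| ≤ embeddingConst a b * ‖w‖ := by
  obtain ⟨y, hy, hvalue⟩ := w.exists_abs_pointValue_le hab
  have hdist : |x - y| ≤ b - a :=
    abs_le.2 ⟨by linarith [hx.1, hy.2], by linarith [hx.2, hy.1]⟩
  have hosc : |pointValue w.toL2 x - pointValue w.toL2 y| ≤ √(b - a) * ‖w‖ :=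
    (w.abs_pointValue_sub_le hab hy hx).trans
      (mul_le_mul_of_nonneg_right (Real.sqrt_le_sqrt hdist) (norm_nonneg _))
  rw [embeddingConst, add_mul]
  linarith [abs_sub_abs_le_abs_sub (pointValue w.toL2 x) (pointValue w.toL2 y)]

theorem H1.ae_abs_toL2_le (hab : a < b) (w : H1 a b) :
    ∀ᵐ x ∂(volume.restrict (Ioo a b)), |w.toL2 x| ≤ embeddingConst a b * ‖w‖ := by
  filter_upwards [w.ae_eq_pointValue hab, ae_restrict_mem measurableSet_Ioo] with x hwx hx
  rw [hwx]
  exact w.abs_pointValue_le hab hx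

/-- Evaluation at an interior point as a bounded functional on `H¹(a, b)`, through which weak
convergence in `H¹` passes to point values. -/
def H1.evalL (hab : a < b) {x : ℝ} (hx : x ∈ Ioo a b) : H1 a b →L[ℝ] ℝ :=
  LinearMap.mkContinuous
    { toFun := fun w => pointValue w.toL2 x
      map_add' := fun w z => w.pointValue_add hab z hx
      map_smul' := fun c w => w.pointValue_smul hab c hx }
    (embeddingConst a b) fun w => w.abs_pointValue_le hab hx

variable {W : ℕ → H1 a b} {w : H1 a b}

theorem TendstoWeakly.grad (hW : TendstoWeakly W atTop w) :
    TendstoWeakly (fun k => (W k).grad) atTop w.grad :=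
  hW.map H1.gradL

theorem TendstoWeakly.exists_ae_abs_toL2_le (hab : a < b) (hW : TendstoWeakly W atTop w) :
    ∃ B, ∀ k, ∀ᵐ x ∂(volume.restrict (Ioo a b)), |(W k).toL2 x| ≤ B := by
  obtain ⟨B, hB⟩ := hW.exists_norm_le
  exact ⟨embeddingConst a b * B, fun k => ((W k).ae_abs_toL2_le hab).mono fun x hx =>
    hx.trans (mul_le_mul_of_nonneg_left (hB k) embeddingConst_nonneg)⟩

theorem TendstoWeakly.exists_abs_pointValue_le (hab : a < b) (hW : TendstoWeakly W atTop w) :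
    ∃ B, ∀ k, ∀ x ∈ Ioo a b, |pointValue (W k).toL2 x| ≤ B := by
  obtain ⟨B, hB⟩ := hW.exists_norm_le
  exact ⟨embeddingConst a b * B, fun k x hx => ((W k).abs_pointValue_le hab hx).trans
    (mul_le_mul_of_nonneg_left (hB k) embeddingConst_nonneg)⟩

theorem TendstoWeakly.tendsto_pointValue (hab : a < b) (hW : TendstoWeakly W atTop w) {c : ℝ}
    (hc : c ∈ Ioo a b) {x : ℕ → ℝ} (hx : Tendsto x atTop (𝓝 c)) :
    Tendsto (fun k => pointValue (W k).toL2 (x k)) atTop (𝓝 (pointValue w.toL2 c)) := by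
  obtain ⟨B, hB⟩ := hW.exists_norm_le
  have hmodulus : Tendsto (fun k => √|x k - c| * B) atTop (𝓝 0) := by
    simpa using (((hx.sub_const c).abs.sqrt).mul_const B)
  have hdiff : Tendsto (fun k => pointValue (W k).toL2 (x k) - pointValue (W k).toL2 c) atTop
      (𝓝 0) := by
    refine squeeze_zero_norm' ?_ hmodulus
    filter_upwards [hx.eventually_mem (isOpen_Ioo.mem_nhds hc)] with k hk
    exact ((W k).abs_pointValue_sub_le hab hc hk).trans
      (mul_le_mul_of_nonneg_left (hB k) (Real.sqrt_nonneg _))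
  have heval : Tendsto (fun k => pointValue (W k).toL2 c) atTop (𝓝 (pointValue w.toL2 c)) :=
    hW (H1.evalL hab hc)
  simpa only [sub_add_cancel, zero_add] using hdiff.add heval

theorem TendstoWeakly.ae_tendsto_toL2 (hab : a < b) (hW : TendstoWeakly W atTop w) :
    ∀ᵐ x ∂(volume.restrict (Ioo a b)),
      Tendsto (fun k => (W k).toL2 x) atTop (𝓝 (w.toL2 x)) := by
  filter_upwards [ae_all_iff.2 fun k => (W k).ae_eq_pointValue hab, w.ae_eq_pointValue hab,
    ae_restrict_mem measurableSet_Ioo] with x hWx hwx hx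
  simpa only [hWx, hwx] using hW.tendsto_pointValue hab hx tendsto_const_nhds

theorem TendstoWeakly.tendsto_toL2 (hab : a < b) (hW : TendstoWeakly W atTop w) :
    Tendsto (fun k => (W k).toL2) atTop (𝓝 w.toL2) := by
  obtain ⟨B, hB⟩ := hW.exists_ae_abs_toL2_le hab
  exact tendsto_Lp_of_dominated (by simp) (memLp_const B) hB (hW.ae_tendsto_toL2 hab)

end PointValue

/-! ### Concentration of rescaled kernels -/

section RescaledKernel

variable {K : ℝ → ℝ} {ε : ℝ}

/-- The kernel `K` centred at `c` and rescaled to width `ε`, with its integral preserved. -/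
def rescaledKernel (K : ℝ → ℝ) (c ε x : ℝ) : ℝ := ε⁻¹ * K ((x - c) / ε)

theorem rescaledKernel_nonneg (hK : ∀ y, 0 ≤ K y) (hε : 0 ≤ ε) (c x : ℝ) :
    0 ≤ rescaledKernel K c ε x :=
  mul_nonneg (inv_nonneg.2 hε) (hK _)

theorem integrable_rescaledKernel (hK : Integrable K) (hε : ε ≠ 0) (c : ℝ) :
    Integrable (rescaledKernel K c ε) :=
  ((hK.comp_div hε).comp_sub_right c).const_mul _

theorem integral_mul_rescaledKernel (V K : ℝ → ℝ) (c : ℝ) (hε : 0 < ε) :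
    ∫ x, V x * rescaledKernel K c ε x = ∫ y, V (c + ε * y) * K y := by
  have htranslate := integral_add_left_eq_self (μ := (volume : Measure ℝ))
    (fun x => V x * rescaledKernel K c ε x) c
  have hscale := Measure.integral_comp_mul_left
    (fun z => V (c + z) * rescaledKernel K c ε (c + z)) ε
  rw [htranslate, abs_of_pos (inv_pos.2 hε), smul_eq_mul, eq_inv_mul_iff_mul_eq₀ hε.ne',
    ← integral_const_mul] at hscale
  rw [← hscale]
  refine integral_congr_ae (ae_of_all _ fun y => ?_)
  simp only [rescaledKernel, add_sub_cancel_left, mul_div_cancel_left₀ _ hε.ne']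
  field_simp

theorem integral_rescaledKernel (K : ℝ → ℝ) (c : ℝ) (hε : 0 < ε) :
    ∫ x, rescaledKernel K c ε x = ∫ y, K y := by
  simpa only [one_mul] using integral_mul_rescaledKernel (fun _ => 1) K c hε

theorem tendsto_integral_mul_rescaledKernel (hK : Integrable K) {ε : ℕ → ℝ}
    (hε : Tendsto ε atTop (𝓝[>] 0)) {V : ℕ → ℝ → ℝ} {c C L : ℝ}
    (hV : ∀ k, AEStronglyMeasurable (V k)) (hC : ∀ k x, |V k x| ≤ C)
    (hlim : ∀ x : ℕ → ℝ, Tendsto x atTop (𝓝 c) → Tendsto (fun k => V k (x k)) atTop (𝓝 L)) :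
    Tendsto (fun k => ∫ x, V k x * rescaledKernel K c (ε k) x) atTop (𝓝 (L * ∫ y, K y)) := by
  have hpos : ∀ᶠ k in atTop, 0 < ε k := hε.eventually self_mem_nhdsWithin
  suffices Tendsto (fun k => ∫ y, V k (c + ε k * y) * K y) atTop (𝓝 (∫ y, L * K y)) by
    rw [integral_const_mul] at this
    exact this.congr' (hpos.mono fun k hk => (integral_mul_rescaledKernel _ _ _ hk).symm)
  refine tendsto_integral_filter_of_dominated_convergence (fun y => C * ‖K y‖) ?_ ?_
    (hK.norm.const_mul C) (ae_of_all _ fun y => ?_)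
  · filter_upwards [hpos] with k hk
    exact ((hV k).comp_quasiMeasurePreserving
      ((quasiMeasurePreserving_add_left volume c).comp
        (Measure.quasiMeasurePreserving_smul volume hk.ne'))).mul hK.aestronglyMeasurable
  · refine Eventually.of_forall fun k => ae_of_all _ fun y => ?_
    rw [norm_mul]
    exact mul_le_mul_of_nonneg_right (hC k _) (norm_nonneg _)
  · refine (hlim _ ?_).mul_const _
    simpa using ((tendsto_nhds_of_tendsto_nhdsWithin hε).mul_const y).const_add c

theorem tendsto_setIntegral_mul_rescaledKernel (hK : Integrable K) {ε : ℕ → ℝ}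
    (hε : Tendsto ε atTop (𝓝[>] 0)) {S : Set ℝ} (hS : MeasurableSet S) {c C L : ℝ} (hc : S ∈ 𝓝 c)
    {V : ℕ → ℝ → ℝ} (hV : ∀ k, AEStronglyMeasurable (V k) (volume.restrict S))
    (hC : ∀ k, ∀ x ∈ S, |V k x| ≤ C)
    (hlim : ∀ x : ℕ → ℝ, Tendsto x atTop (𝓝 c) → Tendsto (fun k => V k (x k)) atTop (𝓝 L)) :
    Tendsto (fun k => ∫ x in S, V k x * rescaledKernel K c (ε k) x) atTop (𝓝 (L * ∫ y, K y)) := by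
  have hC0 : 0 ≤ C := (abs_nonneg _).trans (hC 0 c (mem_of_mem_nhds hc))
  simp only [← integral_indicator hS, indicator_mul_left]
  refine tendsto_integral_mul_rescaledKernel (C := C) hK hε
    (fun k => (aestronglyMeasurable_indicator_iff hS).2 (hV k)) (fun k x => ?_) fun x hx => ?_
  · by_cases hxS : x ∈ S
    · simpa only [indicator_of_mem hxS] using hC k x hxS
    · simpa only [indicator_of_notMem hxS, abs_zero] using hC0
  · exact (hlim x hx).congr' ((hx.eventually_mem hc).mono fun k hk => (indicator_of_mem hk _).symm)

end RescaledKernel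

/-! ### The phase field -/

section PhaseField

variable {a b a₁ b₁ ε : ℝ}

theorem signedDistance_eq (h : a₁ < b₁) (x : ℝ) :
    signedDistance a₁ b₁ x = min (x - a₁) (b₁ - x) := by
  have hdist : Metric.infDist x ({a₁, b₁} : Set ℝ) = min |x - a₁| |x - b₁| := by
    refine le_antisymm (le_min ?_ ?_) ((Metric.le_infDist (insert_nonempty _ _)).2 ?_)
    · exact Metric.infDist_le_dist_of_mem (mem_insert _ _)
    · exact Metric.infDist_le_dist_of_mem (mem_insert_of_mem _ rfl)
    · rintro y (rfl | rfl)
      · exact min_le_left _ _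
      · exact min_le_right _ _
  rw [signedDistance, frontier_Ioo h, hdist]
  split_ifs with hx
  · rw [abs_of_pos (sub_pos.2 hx.1), abs_of_neg (sub_neg.2 hx.2), neg_sub]
  · rcases le_or_gt x a₁ with hxa | hxa
    · rw [abs_of_nonpos (by linarith), abs_of_neg (by linarith), min_eq_left (by linarith),
        min_eq_left (by linarith), neg_neg]
    · have hxb : b₁ ≤ x := not_lt.1 fun hxb => hx ⟨hxa, hxb⟩
      rw [abs_of_nonneg (by linarith), abs_of_nonneg (by linarith), min_eq_right (by linarith),
        min_eq_right (by linarith), neg_sub]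

theorem half_one_add_tanh_eq_sigmoid (y : ℝ) :
    1 / 2 * (1 + Real.tanh y) = Real.sigmoid (2 * y) := by
  have := Real.exp_pos y
  rw [Real.sigmoid_def, Real.tanh_eq, two_mul, neg_add, Real.exp_add, Real.exp_neg]
  field_simp
  ring

theorem phaseField_eq_sigmoid (h : a₁ < b₁) (x : ℝ) :
    phaseField a₁ b₁ ε x = Real.sigmoid (min (x - a₁) (b₁ - x) / (ε / 2)) := by
  rw [phaseField, half_one_add_tanh_eq_sigmoid, signedDistance_eq h, div_div_eq_mul_div,
    mul_comm 2, div_mul_eq_mul_div]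

theorem continuous_phaseField (h : a₁ < b₁) : Continuous (phaseField a₁ b₁ ε) := by
  rw [funext (phaseField_eq_sigmoid h)]
  exact continuous_sigmoid.comp (by fun_prop)

theorem phaseField_mem_Icc (x : ℝ) : phaseField a₁ b₁ ε x ∈ Icc (0 : ℝ) 1 := by
  rw [phaseField, half_one_add_tanh_eq_sigmoid]
  exact ⟨Real.sigmoid_nonneg _, Real.sigmoid_le_one _⟩

theorem ae_tendsto_phaseField (h : a₁ < b₁) {ε : ℕ → ℝ} (hε : Tendsto ε atTop (𝓝[>] 0)) :
    ∀ᵐ x, Tendsto (fun k => phaseField a₁ b₁ (ε k) x) atTop (𝓝 ((Ioo a₁ b₁).indicator 1 x)) := by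
  have hinv : Tendsto (fun k => (ε k / 2)⁻¹) atTop atTop := by
    simpa only [Function.comp_apply, ← div_eq_mul_inv, inv_div] using
      (tendsto_inv_nhdsGT_zero.comp hε).const_mul_atTop (two_pos (α := ℝ))
  filter_upwards [Measure.ae_ne volume a₁, Measure.ae_ne volume b₁] with x ha hb
  simp only [phaseField_eq_sigmoid h, div_eq_mul_inv _ (_ / _)]
  by_cases hx : x ∈ Ioo a₁ b₁
  · have hpos : 0 < min (x - a₁) (b₁ - x) := lt_min (sub_pos.2 hx.1) (sub_pos.2 hx.2)
    rw [indicator_of_mem hx]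
    exact Real.tendsto_sigmoid_atTop.comp (hinv.const_mul_atTop hpos)
  · have hneg : min (x - a₁) (b₁ - x) < 0 := by
      by_contra! hmin
      obtain ⟨hxa, hxb⟩ := le_min_iff.1 hmin
      exact hx ⟨(sub_nonneg.1 hxa).lt_of_ne ha.symm, (sub_nonneg.1 hxb).lt_of_ne hb⟩
    rw [indicator_of_notMem hx]
    exact Real.tendsto_sigmoid_atBot.comp (hinv.const_mul_atTop_of_neg hneg)

theorem deriv_sigmoid_nonneg (y : ℝ) : 0 ≤ deriv Real.sigmoid y :=
  Real.sigmoid_monotone.deriv_nonneg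

theorem deriv_sigmoid_neg (y : ℝ) : deriv Real.sigmoid (-y) = deriv Real.sigmoid y := by
  simp only [Real.deriv_sigmoid, Real.sigmoid_neg]
  ring

theorem integrable_deriv_sigmoid : Integrable (deriv Real.sigmoid) := by
  have hright : IntegrableOn (deriv Real.sigmoid) (Ioi 0) :=
    integrableOn_Ioi_deriv_of_nonneg' (fun y _ => differentiableAt_sigmoid.hasDerivAt)
      (fun y _ => deriv_sigmoid_nonneg y) Real.tendsto_sigmoid_atTop
  have hleft : IntegrableOn (deriv Real.sigmoid) (Iic 0) := by
    simpa only [Function.comp_def, deriv_sigmoid_neg, neg_preimage, neg_Ici, neg_zero] using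
      ((Measure.measurePreserving_neg (volume : Measure ℝ)).integrableOn_comp_preimage
        (MeasurableEquiv.neg ℝ).measurableEmbedding).2
        ((integrableOn_Ici_iff_integrableOn_Ioi).2 hright)
  rw [← integrableOn_univ, ← Iic_union_Ioi (a := (0 : ℝ))]
  exact hleft.union hright

theorem integral_deriv_sigmoid : ∫ y, deriv Real.sigmoid y = 1 := by
  rw [integral_of_hasDerivAt_of_tendsto (fun y => differentiableAt_sigmoid.hasDerivAt)
    integrable_deriv_sigmoid Real.tendsto_sigmoid_atBot Real.tendsto_sigmoid_atTop, sub_zero]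

theorem abs_deriv_phaseField_of_lt (h : a₁ < b₁) (hε : 0 < ε) {x : ℝ}
    (hx : x < (a₁ + b₁) / 2) :
    |deriv (phaseField a₁ b₁ ε) x| = rescaledKernel (deriv Real.sigmoid) a₁ (ε / 2) x := by
  have hloc : phaseField a₁ b₁ ε =ᶠ[𝓝 x] fun y => Real.sigmoid ((y - a₁) / (ε / 2)) := by
    filter_upwards [Iio_mem_nhds hx] with y (hy : y < (a₁ + b₁) / 2)
    rw [phaseField_eq_sigmoid h, min_eq_left (by linarith)]
  have hderiv : HasDerivAt (fun y => Real.sigmoid ((y - a₁) / (ε / 2)))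
      (rescaledKernel (deriv Real.sigmoid) a₁ (ε / 2) x) x := by
    refine (differentiableAt_sigmoid.hasDerivAt.comp x
      (((hasDerivAt_id x).sub_const a₁).div_const (ε / 2))).congr_deriv ?_
    simp only [rescaledKernel, id]
    ring
  rw [hloc.deriv_eq, hderiv.deriv,
    abs_of_nonneg (rescaledKernel_nonneg deriv_sigmoid_nonneg (half_pos hε).le _ _)]

theorem abs_deriv_phaseField_of_gt (h : a₁ < b₁) (hε : 0 < ε) {x : ℝ}
    (hx : (a₁ + b₁) / 2 < x) :
    |deriv (phaseField a₁ b₁ ε) x| = rescaledKernel (deriv Real.sigmoid) b₁ (ε / 2) x := by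
  have hloc : phaseField a₁ b₁ ε =ᶠ[𝓝 x] fun y => Real.sigmoid ((b₁ - y) / (ε / 2)) := by
    filter_upwards [Ioi_mem_nhds hx] with y (hy : (a₁ + b₁) / 2 < y)
    rw [phaseField_eq_sigmoid h, min_eq_right (by linarith)]
  have hderiv : HasDerivAt (fun y => Real.sigmoid ((b₁ - y) / (ε / 2)))
      (-rescaledKernel (deriv Real.sigmoid) b₁ (ε / 2) x) x := by
    refine (differentiableAt_sigmoid.hasDerivAt.comp x
      (((hasDerivAt_id x).const_sub b₁).div_const (ε / 2))).congr_deriv ?_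
    simp only [rescaledKernel, id, ← deriv_sigmoid_neg ((x - b₁) / _), ← neg_div, neg_sub]
    ring
  rw [hloc.deriv_eq, hderiv.deriv, abs_neg,
    abs_of_nonneg (rescaledKernel_nonneg deriv_sigmoid_nonneg (half_pos hε).le _ _)]

theorem ae_abs_deriv_phaseField_le (h : a₁ < b₁) (hε : 0 < ε) :
    ∀ᵐ x, |deriv (phaseField a₁ b₁ ε) x| ≤ rescaledKernel (deriv Real.sigmoid) a₁ (ε / 2) x +
      rescaledKernel (deriv Real.sigmoid) b₁ (ε / 2) x := by
  have hnonneg := rescaledKernel_nonneg deriv_sigmoid_nonneg (half_pos hε).le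
  filter_upwards [Measure.ae_ne volume ((a₁ + b₁) / 2)] with x hx
  rcases hx.lt_or_gt with hlt | hgt
  · exact (abs_deriv_phaseField_of_lt h hε hlt).trans_le (le_add_of_nonneg_right (hnonneg b₁ x))
  · exact (abs_deriv_phaseField_of_gt h hε hgt).trans_le (le_add_of_nonneg_left (hnonneg a₁ x))

theorem integrable_abs_deriv_phaseField (h : a₁ < b₁) (hε : 0 < ε) :
    Integrable fun x => |deriv (phaseField a₁ b₁ ε) x| := by
  have hkernel := integrable_rescaledKernel integrable_deriv_sigmoid (half_pos hε).ne'
  refine ((hkernel a₁).add (hkernel b₁)).mono' (measurable_deriv _).abs.aestronglyMeasurable ?_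
  simpa only [Real.norm_eq_abs, abs_abs, Pi.add_apply] using ae_abs_deriv_phaseField_le h hε

theorem setIntegral_abs_deriv_phaseField_le (h : a₁ < b₁) (hε : 0 < ε) (S : Set ℝ) :
    ∫ x in S, |deriv (phaseField a₁ b₁ ε) x| ≤ 2 := by
  have hint := integrable_abs_deriv_phaseField h hε
  have hkernel := integrable_rescaledKernel integrable_deriv_sigmoid (half_pos hε).ne'
  calc ∫ x in S, |deriv (phaseField a₁ b₁ ε) x|
      ≤ ∫ x, |deriv (phaseField a₁ b₁ ε) x| :=
        setIntegral_le_integral hint (ae_of_all _ fun x => abs_nonneg _)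
    _ ≤ ∫ x, (rescaledKernel (deriv Real.sigmoid) a₁ (ε / 2) x +
          rescaledKernel (deriv Real.sigmoid) b₁ (ε / 2) x) :=
        integral_mono_ae hint ((hkernel a₁).add (hkernel b₁)) (ae_abs_deriv_phaseField_le h hε)
    _ = 2 := by
        rw [integral_add (hkernel a₁) (hkernel b₁), integral_rescaledKernel _ _ (half_pos hε),
          integral_rescaledKernel _ _ (half_pos hε), integral_deriv_sigmoid, one_add_one_eq_two]

theorem tendsto_integral_mul_abs_deriv_phaseField (ha : a < a₁) (h : a₁ < b₁) (hb : b₁ < b)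
    {ε : ℕ → ℝ} (hε : Tendsto ε atTop (𝓝[>] 0)) {V : ℕ → ℝ → ℝ} {V₀ : ℝ → ℝ} {C : ℝ}
    (hV : ∀ k, ContinuousOn (V k) (Ioo a b)) (hC : ∀ k, ∀ x ∈ Ioo a b, |V k x| ≤ C)
    (hlim : ∀ c ∈ Ioo a b, ∀ x : ℕ → ℝ, Tendsto x atTop (𝓝 c) →
      Tendsto (fun k => V k (x k)) atTop (𝓝 (V₀ c))) :
    Tendsto (fun k => ∫ x in Ioo a b, V k x * |deriv (phaseField a₁ b₁ (ε k)) x|) atTop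
      (𝓝 (V₀ a₁ + V₀ b₁)) := by
  set m := (a₁ + b₁) / 2 with hm
  have ham : a < m := by linarith
  have hmb : m < b := by linarith
  have hpos : ∀ᶠ k in atTop, 0 < ε k := hε.eventually self_mem_nhdsWithin
  have hhalf : Tendsto (fun k => ε k / 2) atTop (𝓝[>] 0) :=
    tendsto_nhdsWithin_iff.2 ⟨by simpa only [zero_div] using
      (tendsto_nhds_of_tendsto_nhdsWithin hε).div_const 2, hpos.mono fun k hk => half_pos hk⟩
  have hconc {S : Set ℝ} (hS : MeasurableSet S) (hSab : S ⊆ Ioo a b) {c : ℝ} (hc : S ∈ 𝓝 c) :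
      Tendsto (fun k => ∫ x in S, V k x * rescaledKernel (deriv Real.sigmoid) c (ε k / 2) x) atTop
        (𝓝 (V₀ c)) := by
    simpa only [integral_deriv_sigmoid, mul_one] using
      tendsto_setIntegral_mul_rescaledKernel integrable_deriv_sigmoid hhalf hS hc
        (fun k => ((hV k).mono hSab).aestronglyMeasurable hS) (fun k x hx => hC k x (hSab hx))
        (hlim c (hSab (mem_of_mem_nhds hc)))
  refine ((hconc measurableSet_Ioo (Ioo_subset_Ioo_right hmb.le)
    (Ioo_mem_nhds ha (by linarith))).add (hconc measurableSet_Ioo (Ioo_subset_Ioo_left ham.le)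
    (Ioo_mem_nhds (by linarith) hb))).congr' ?_
  filter_upwards [hpos] with k hk
  have hint : IntegrableOn (fun x => V k x * |deriv (phaseField a₁ b₁ (ε k)) x|) (Ioo a b) :=
    (integrable_abs_deriv_phaseField h hk).integrableOn.bdd_mul
      ((hV k).aestronglyMeasurable measurableSet_Ioo)
      ((ae_restrict_mem measurableSet_Ioo).mono (hC k))
  rw [← Ioc_union_Ioo_eq_Ioo ham.le hmb, setIntegral_union
    (disjoint_left.2 fun x hxl hxr => hxl.2.not_gt hxr.1) measurableSet_Ioo
    (hint.mono_set (Ioc_subset_Ioo_right hmb)) (hint.mono_set (Ioo_subset_Ioo_left ham.le)),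
    integral_Ioc_eq_integral_Ioo]
  exact congrArg₂ (· + ·)
    (setIntegral_congr_fun measurableSet_Ioo fun x hx => by
      simp only [abs_deriv_phaseField_of_lt h hk hx.2])
    (setIntegral_congr_fun measurableSet_Ioo fun x hx => by
      simp only [abs_deriv_phaseField_of_gt h hk hx.1])

end PhaseField

/-! ### Energies of a two-phase medium -/

section Blend

variable {a b a₁ b₁ : ℝ} {θ : ℝ → ℝ}

/-- A phase function: at each point, the proportion of the second of two materials. -/
structure IsPhase (θ : ℝ → ℝ) : Prop where
  measurable : Measurable θ
  mem_Icc : ∀ x, θ x ∈ Icc (0 : ℝ) 1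

theorem isPhase_phaseField (h₁ : a₁ < b₁) (ε : ℝ) : IsPhase (phaseField a₁ b₁ ε) :=
  ⟨(continuous_phaseField h₁).measurable, phaseField_mem_Icc⟩

theorem isPhase_indicator {S : Set ℝ} (hS : MeasurableSet S) : IsPhase (S.indicator 1) :=
  ⟨measurable_one.indicator hS, fun x =>
    ⟨indicator_nonneg (fun _ _ => zero_le_one) x, indicator_le_self' (fun _ _ => zero_le_one) x⟩⟩

/-- The mixture of the coefficients `s` and `t` according to the phase function `θ`. It is `diffuse`
when `θ` is the phase field and, almost everywhere, `sharp` when `θ` is the indicator of `Ω₁`. -/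
def blend (θ s t : ℝ → ℝ) (x : ℝ) : ℝ := s x + (t x - s x) * θ x

theorem ae_sharp_eq_blend (s t : ℝ → ℝ) :
    ∀ᵐ x ∂(volume.restrict (Ioo a b)),
      sharp a a₁ b₁ b s t x = blend ((Ioo a₁ b₁).indicator 1) s t x := by
  filter_upwards [ae_restrict_mem measurableSet_Ioo, Measure.ae_ne _ a₁, Measure.ae_ne _ b₁]
    with x hx ha hb
  rw [sharp, blend]
  by_cases hin : x ∈ Ioo a₁ b₁
  · have hout : x ∉ Ioo a a₁ ∪ Ioo b₁ b := by
      rintro (hl | hr)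
      exacts [hl.2.not_gt hin.1, hr.1.not_gt hin.2]
    simp [hin, hout]
  · have hout : x ∈ Ioo a a₁ ∪ Ioo b₁ b := by
      rcases ha.lt_or_gt with hl | hr
      · exact Or.inl ⟨hx.1, hl⟩
      · exact Or.inr ⟨(not_lt.1 fun hlt => hin ⟨hr, hlt⟩).lt_of_ne hb.symm, hx.2⟩
    simp [hin, hout]

theorem IsPhase.abs_blend_le (hθ : IsPhase θ) (s t : ℝ → ℝ) (x : ℝ) :
    |blend θ s t x| ≤ |s x| + |t x| := by
  obtain ⟨h0, h1⟩ := hθ.mem_Icc x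
  calc |blend θ s t x| = |(1 - θ x) * s x + θ x * t x| := by rw [blend]; ring_nf
    _ ≤ (1 - θ x) * |s x| + θ x * |t x| := by
        refine (abs_add_le _ _).trans_eq ?_
        rw [abs_mul, abs_mul, abs_of_nonneg h0, abs_of_nonneg (sub_nonneg.2 h1)]
    _ ≤ |s x| + |t x| :=
        add_le_add (mul_le_of_le_one_left (abs_nonneg _) (sub_le_self _ h0))
          (mul_le_of_le_one_left (abs_nonneg _) h1)

theorem IsPhase.le_blend (hθ : IsPhase θ) {s t : ℝ → ℝ} {m x : ℝ} (hs : m ≤ s x) (ht : m ≤ t x) :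
    m ≤ blend θ s t x := by
  obtain ⟨h0, h1⟩ := hθ.mem_Icc x
  calc m = (1 - θ x) * m + θ x * m := by ring
    _ ≤ (1 - θ x) * s x + θ x * t x := by gcongr
    _ = blend θ s t x := by rw [blend]; ring

theorem IsPhase.aestronglyMeasurable_blend (hθ : IsPhase θ) {s t : ℝ → ℝ} {μ : Measure ℝ}
    (hs : AEStronglyMeasurable s μ) (ht : AEStronglyMeasurable t μ) :
    AEStronglyMeasurable (blend θ s t) μ :=
  hs.add ((ht.sub hs).mul hθ.measurable.aestronglyMeasurable)

theorem IsPhase.integrable_blend_mul_sq (hθ : IsPhase θ) (s t : ℝ) (v : L2 a b) :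
    Integrable (fun x => blend θ (fun _ => s) (fun _ => t) x * v x ^ 2)
      (volume.restrict (Ioo a b)) := by
  simpa only [sq] using integrable_weight_mul
    (hθ.aestronglyMeasurable_blend aestronglyMeasurable_const aestronglyMeasurable_const)
    (ae_of_all _ (hθ.abs_blend_le _ _)) v v

theorem IsPhase.integrable_blend_mul (hθ : IsPhase θ) (s t v : L2 a b) :
    Integrable (fun x => blend θ s t x * v x) (volume.restrict (Ioo a b)) := by
  have hblend : MemLp (blend θ s t) 2 (volume.restrict (Ioo a b)) :=
    ((Lp.memLp s).norm.add (Lp.memLp t).norm).of_le (hθ.aestronglyMeasurable_blend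
      (Lp.aestronglyMeasurable s) (Lp.aestronglyMeasurable t))
      (ae_of_all _ fun x => (hθ.abs_blend_le _ _ x).trans (le_abs_self _))
  exact hblend.integrable_mul (q := 2) (Lp.memLp v)

end Blend

section BulkEnergy

variable {a b α β γ : ℝ} {θ : ℝ → ℝ}

/-- The bulk part of the energies, for the material distribution given by the phase function `θ`. -/
def bulkEnergy (α β γ : ℝ) (h q : L2 a b) (θ : ℝ → ℝ) (u : H1 a b) : ℝ :=
  ∫ x in Ioo a b, (1 / 2 * (blend θ (fun _ => α) (fun _ => 1) x * u.grad x ^ 2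
    + blend θ (fun _ => β) (fun _ => γ) x * u.toL2 x ^ 2) - blend θ h q x * u.toL2 x)

theorem IsPhase.integrable_bulkEnergy (hθ : IsPhase θ) (h q : L2 a b) (u : H1 a b) :
    Integrable (fun x => 1 / 2 * (blend θ (fun _ => α) (fun _ => 1) x * u.grad x ^ 2
      + blend θ (fun _ => β) (fun _ => γ) x * u.toL2 x ^ 2) - blend θ h q x * u.toL2 x)
      (volume.restrict (Ioo a b)) :=
  (((hθ.integrable_blend_mul_sq _ _ _).add (hθ.integrable_blend_mul_sq _ _ _)).const_mul _).sub
    (hθ.integrable_blend_mul _ _ _)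

/-- The part of the bulk energy that is continuous along weakly convergent sequences in `H¹`. -/
def lowerOrderEnergy (β γ : ℝ) (h q : L2 a b) (θ : ℝ → ℝ) (u : H1 a b) : ℝ :=
  ∫ x in Ioo a b, (1 / 2 * (blend θ (fun _ => β) (fun _ => γ) x * u.toL2 x ^ 2)
    - blend θ h q x * u.toL2 x)

theorem IsPhase.integrable_lowerOrderEnergy (hθ : IsPhase θ) (h q : L2 a b) (u : H1 a b) :
    Integrable (fun x => 1 / 2 * (blend θ (fun _ => β) (fun _ => γ) x * u.toL2 x ^ 2)
      - blend θ h q x * u.toL2 x) (volume.restrict (Ioo a b)) :=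
  ((hθ.integrable_blend_mul_sq _ _ _).const_mul _).sub (hθ.integrable_blend_mul _ _ _)

theorem IsPhase.bulkEnergy_eq (hθ : IsPhase θ) (h q : L2 a b) (u : H1 a b) :
    bulkEnergy α β γ h q θ u =
      1 / 2 * (∫ x in Ioo a b, blend θ (fun _ => α) (fun _ => 1) x * u.grad x ^ 2) +
        lowerOrderEnergy β γ h q θ u := by
  rw [lowerOrderEnergy, ← integral_const_mul, ← integral_add
    ((hθ.integrable_blend_mul_sq _ _ _).const_mul _) (hθ.integrable_lowerOrderEnergy _ _ _)]
  exact integral_congr_ae (ae_of_all _ fun x => by ring)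

theorem IsPhase.le_bulkEnergy (hab : a < b) (hθ : IsPhase θ) {m : ℝ} (hα : m ≤ α)
    (h1 : m ≤ 1) (hβ : m ≤ β) (hγ : m ≤ γ) (h q : L2 a b) (u : H1 a b) :
    1 / 2 * m * ‖u‖ ^ 2 - (∫ x in Ioo a b, (|h x| + |q x|)) * (embeddingConst a b * ‖u‖) ≤
      bulkEnergy α β γ h q θ u := by
  have hgrad := (Lp.memLp u.grad).integrable_sq
  have hval := (Lp.memLp u.toL2).integrable_sq
  have hquad : Integrable (fun x => 1 / 2 * m * (u.toL2 x ^ 2 + u.grad x ^ 2))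
      (volume.restrict (Ioo a b)) := (hval.add hgrad).const_mul _
  have hload : Integrable (fun x => (|h x| + |q x|) * (embeddingConst a b * ‖u‖))
      (volume.restrict (Ioo a b)) := (h.integrable.abs.add q.integrable.abs).mul_const _
  rw [u.norm_sq_eq, norm_sq_eq_integral_sq, norm_sq_eq_integral_sq, ← integral_add hval hgrad,
    ← integral_const_mul, ← integral_mul_const, ← integral_sub hquad hload]
  refine integral_mono_ae (hquad.sub hload) (hθ.integrable_bulkEnergy h q u) ?_
  filter_upwards [u.ae_abs_toL2_le hab] with x hx
  have hD := mul_le_mul_of_nonneg_right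
    (hθ.le_blend (s := fun _ => α) (t := fun _ => 1) (x := x) hα h1) (sq_nonneg (u.grad x))
  have hc := mul_le_mul_of_nonneg_right
    (hθ.le_blend (s := fun _ => β) (t := fun _ => γ) (x := x) hβ hγ) (sq_nonneg (u.toL2 x))
  have hf : blend θ h q x * u.toL2 x ≤ (|h x| + |q x|) * (embeddingConst a b * ‖u‖) := by
    refine (le_abs_self _).trans ?_
    rw [abs_mul]
    exact mul_le_mul (hθ.abs_blend_le _ _ x) hx (abs_nonneg _) (by positivity)
  linarith

end BulkEnergy

section BulkConvergence

variable {a b α β γ : ℝ} {θ : ℕ → ℝ → ℝ} {θ₀ : ℝ → ℝ}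

theorem TendstoWeakly.tendsto_lowerOrderEnergy (hab : a < b) (hθ : ∀ k, IsPhase (θ k))
    (hlim : ∀ᵐ x ∂(volume.restrict (Ioo a b)), Tendsto (fun k => θ k x) atTop (𝓝 (θ₀ x)))
    {W : ℕ → H1 a b} {w : H1 a b} (hW : TendstoWeakly W atTop w) (h q : L2 a b) :
    Tendsto (fun k => lowerOrderEnergy β γ h q (θ k) (W k)) atTop
      (𝓝 (lowerOrderEnergy β γ h q θ₀ w)) := by
  obtain ⟨B, hB⟩ := hW.exists_ae_abs_toL2_le hab
  refine tendsto_integral_of_dominated_convergence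
    (fun x => 1 / 2 * ((|β| + |γ|) * B ^ 2) + (|h x| + |q x|) * B)
    (fun k => ((hθ k).integrable_lowerOrderEnergy h q (W k)).aestronglyMeasurable)
    ((integrable_const _).add ((h.integrable.abs.add q.integrable.abs).mul_const B))
    (fun k => ?_) ?_
  · filter_upwards [hB k] with x hx
    refine (abs_sub _ _).trans ?_
    rw [abs_mul, abs_mul, abs_mul, abs_pow, abs_of_pos (one_half_pos (α := ℝ))]
    have := (hθ k).abs_blend_le (fun _ => β) (fun _ => γ) x
    have := (hθ k).abs_blend_le h q x
    gcongr
  · filter_upwards [hlim, hW.ae_tendsto_toL2 hab] with x hθx hWx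
    have hblend (s t : ℝ → ℝ) : Tendsto (fun k => blend (θ k) s t x) atTop (𝓝 (blend θ₀ s t x)) :=
      (hθx.const_mul _).const_add _
    exact (((hblend _ _).mul (hWx.pow 2)).const_mul _).sub ((hblend _ _).mul hWx)

theorem TendstoWeakly.bulkEnergy_le (hab : a < b) (hα : 0 ≤ α) (hθ : ∀ k, IsPhase (θ k))
    (hθ₀ : IsPhase θ₀)
    (hlim : ∀ᵐ x ∂(volume.restrict (Ioo a b)), Tendsto (fun k => θ k x) atTop (𝓝 (θ₀ x)))
    {W : ℕ → H1 a b} {w : H1 a b} (hW : TendstoWeakly W atTop w) {h q : L2 a b} {e : ℕ → ℝ}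
    {e₀ : ℝ} (he : Tendsto e atTop (𝓝 e₀))
    (hle : ∀ᶠ k in atTop, bulkEnergy α β γ h q (θ k) (W k) ≤ e k) :
    bulkEnergy α β γ h q θ₀ w ≤ e₀ := by
  have hgrad : ∫ x in Ioo a b, blend θ₀ (fun _ => α) (fun _ => 1) x * w.grad x ^ 2 ≤
      2 * (e₀ - lowerOrderEnergy β γ h q θ₀ w) :=
    hW.grad.integral_mul_sq_le
      (fun k => (hθ k).aestronglyMeasurable_blend aestronglyMeasurable_const
        aestronglyMeasurable_const)
      (fun k => ae_of_all _ fun x => (hθ k).le_blend hα zero_le_one)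
      (fun k => ae_of_all _ ((hθ k).abs_blend_le (fun _ => α) (fun _ => 1)))
      (hlim.mono fun x hx => (hx.const_mul _).const_add _)
      ((he.sub (hW.tendsto_lowerOrderEnergy hab hθ hlim h q)).const_mul 2)
      (hle.mono fun k hk => by
        rw [(hθ k).bulkEnergy_eq] at hk
        linarith)
  rw [hθ₀.bulkEnergy_eq]
  linarith

theorem tendsto_bulkEnergy (hab : a < b) (hθ : ∀ k, IsPhase (θ k)) (hθ₀ : IsPhase θ₀)
    (hlim : ∀ᵐ x ∂(volume.restrict (Ioo a b)), Tendsto (fun k => θ k x) atTop (𝓝 (θ₀ x)))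
    (h q : L2 a b) (u : H1 a b) :
    Tendsto (fun k => bulkEnergy α β γ h q (θ k) u) atTop (𝓝 (bulkEnergy α β γ h q θ₀ u)) := by
  rw [hθ₀.bulkEnergy_eq]
  refine Tendsto.congr (fun k => ((hθ k).bulkEnergy_eq h q u).symm) ((Tendsto.const_mul _ ?_).add
    ((tendstoWeakly_const u atTop).tendsto_lowerOrderEnergy hab hθ hlim h q))
  refine tendsto_integral_of_dominated_convergence (fun x => (|α| + |1|) * u.grad x ^ 2)
    (fun k => ((hθ k).integrable_blend_mul_sq α 1 u.grad).aestronglyMeasurable)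
    ((Lp.memLp u.grad).integrable_sq.const_mul _) (fun k => ae_of_all _ fun x => ?_) ?_
  · rw [Real.norm_eq_abs, abs_mul, abs_sq]
    exact mul_le_mul_of_nonneg_right ((hθ k).abs_blend_le _ _ x) (sq_nonneg _)
  · filter_upwards [hlim] with x hx
    exact ((hx.const_mul _).const_add _).mul_const _

end BulkConvergence

section SurfaceEnergy

variable {a b a₁ b₁ κ : ℝ}

/-- The density `κ u² / 2 + g u` of the surface part of the energies, for the continuous
representatives of `g` and `u`. -/
def surfaceDensity (κ : ℝ) (g u : H1 a b) (x : ℝ) : ℝ :=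
  1 / 2 * κ * pointValue u.toL2 x ^ 2 + pointValue g.toL2 x * pointValue u.toL2 x

theorem continuousOn_surfaceDensity (hab : a < b) (g u : H1 a b) :
    ContinuousOn (surfaceDensity κ g u) (Ioo a b) :=
  (continuousOn_const.mul ((u.continuousOn_pointValue hab).pow 2)).add
    ((g.continuousOn_pointValue hab).mul (u.continuousOn_pointValue hab))

theorem abs_surfaceDensity_le {g u : H1 a b} {x A B : ℝ} (hg : |pointValue g.toL2 x| ≤ A)
    (hu : |pointValue u.toL2 x| ≤ B) : |surfaceDensity κ g u x| ≤ |1 / 2 * κ| * B ^ 2 + A * B := by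
  refine (abs_add_le _ _).trans ?_
  rw [abs_mul, abs_mul (pointValue g.toL2 x), abs_pow]
  have := (abs_nonneg _).trans hg
  gcongr

theorem integrable_surfaceDensity_mul (hab : a < b) {ρ : ℝ → ℝ} (hρ : IntegrableOn ρ (Ioo a b))
    (g u : H1 a b) : IntegrableOn (fun x => surfaceDensity κ g u x * ρ x) (Ioo a b) :=
  hρ.bdd_mul ((continuousOn_surfaceDensity hab g u).aestronglyMeasurable measurableSet_Ioo)
    ((ae_restrict_mem measurableSet_Ioo).mono fun _ hx =>
      abs_surfaceDensity_le (g.abs_pointValue_le hab hx) (u.abs_pointValue_le hab hx))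

theorem le_setIntegral_surfaceDensity_mul (hab : a < b) (hκ : 0 ≤ κ) {ρ : ℝ → ℝ}
    (hρ : IntegrableOn ρ (Ioo a b)) (hρ0 : ∀ x, 0 ≤ ρ x) (g u : H1 a b) :
    -(embeddingConst a b * ‖g‖ * (embeddingConst a b * ‖u‖) * ∫ x in Ioo a b, ρ x) ≤
      ∫ x in Ioo a b, surfaceDensity κ g u x * ρ x := by
  rw [← neg_mul, ← integral_const_mul]
  refine setIntegral_mono_on (hρ.const_mul _) (integrable_surfaceDensity_mul hab hρ g u)
    measurableSet_Ioo fun x hx => mul_le_mul_of_nonneg_right ?_ (hρ0 x)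
  have hquad : 0 ≤ 1 / 2 * κ * pointValue u.toL2 x ^ 2 := by positivity
  have hlin : |pointValue g.toL2 x * pointValue u.toL2 x| ≤
      embeddingConst a b * ‖g‖ * (embeddingConst a b * ‖u‖) := by
    rw [abs_mul]
    exact mul_le_mul (g.abs_pointValue_le hab hx) (u.abs_pointValue_le hab hx) (abs_nonneg _)
      (mul_nonneg embeddingConst_nonneg (norm_nonneg g))
  rw [surfaceDensity]
  linarith [neg_le_of_abs_le hlin]

theorem TendstoWeakly.tendsto_integral_surfaceDensity (ha : a < a₁) (h₁ : a₁ < b₁) (hb : b₁ < b)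
    {ε : ℕ → ℝ} (hε : Tendsto ε atTop (𝓝[>] 0)) {W : ℕ → H1 a b} {w : H1 a b}
    (hW : TendstoWeakly W atTop w) (g : H1 a b) :
    Tendsto (fun k => ∫ x in Ioo a b, surfaceDensity κ g (W k) x *
        |deriv (phaseField a₁ b₁ (ε k)) x|) atTop
      (𝓝 (surfaceDensity κ g w a₁ + surfaceDensity κ g w b₁)) := by
  have hab : a < b := ha.trans (h₁.trans hb)
  obtain ⟨B, hB⟩ := hW.exists_abs_pointValue_le hab
  refine tendsto_integral_mul_abs_deriv_phaseField ha h₁ hb hε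
    (fun k => continuousOn_surfaceDensity hab g (W k))
    (fun k x hx => abs_surfaceDensity_le (g.abs_pointValue_le hab hx) (hB k x hx))
    fun c hc x hx => ?_
  have hu := hW.tendsto_pointValue hab hc hx
  have hg := (tendstoWeakly_const g atTop).tendsto_pointValue hab hc hx
  exact ((hu.pow 2).const_mul _).add (hg.mul hu)

end SurfaceEnergy

/-! ### Γ-convergence of functionals on `H¹` extended by `+∞` -/

section ExtendTop

variable {a b : ℝ}

theorem extendTop_toL2 (E : H1 a b → ℝ) (w : H1 a b) : extendTop E w.toL2 = (E w : EReal) := by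
  have hw : ∃ z : H1 a b, z.toL2 = w.toL2 := ⟨w, rfl⟩
  rw [extendTop, dif_pos hw, H1.toL2_injective hw.choose_spec]

theorem exists_of_extendTop_lt {E : H1 a b → ℝ} {u : L2 a b} {M : ℝ} (hu : extendTop E u < M) :
    ∃ w : H1 a b, w.toL2 = u ∧ E w < M := by
  by_cases hw : ∃ w : H1 a b, w.toL2 = u
  · obtain ⟨w, rfl⟩ := hw
    exact ⟨w, rfl, by rwa [extendTop_toL2, EReal.coe_lt_coe_iff] at hu⟩
  · rw [extendTop, dif_neg hw] at hu
    exact absurd hu not_top_lt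

theorem energyCompact_extendTop (hab : a < b) {E : ℝ → H1 a b → ℝ}
    (hE : ∀ M, ∃ B, ∀ ε ∈ Ioo (0 : ℝ) 1, ∀ w, E ε w < M → ‖w‖ ≤ B) :
    EnergyCompact fun ε => extendTop (E ε) := by
  intro ε hε _ U M hU
  choose V hVU hVM using fun k => exists_of_extendTop_lt (hU k)
  obtain ⟨B, hB⟩ := hE M
  obtain ⟨w, σ, hσ, hw⟩ :=
    exists_subseq_tendstoWeakly fun k => hB (ε k) (hε k) (V k) (hVM k)
  obtain rfl : (fun k => (V k).toL2) = U := funext hVU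
  exact ⟨σ, fun j => V (σ j), w, hσ, fun _ => rfl, hw.tendsto_toL2 hab, hw,
    hw.ae_tendsto_toL2 hab⟩

theorem extendTop_le_liminf {E : ℝ → H1 a b → ℝ} {E₀ : H1 a b → ℝ}
    (hcompact : EnergyCompact fun ε => extendTop (E ε))
    (hlsc : ∀ (ε : ℕ → ℝ) (W : ℕ → H1 a b) (w : H1 a b) (c : ℝ), Tendsto ε atTop (𝓝[>] 0) →
      TendstoWeakly W atTop w → (∀ k, E (ε k) (W k) ≤ c) → E₀ w ≤ c)
    {ε : ℕ → ℝ} (hε : ∀ k, ε k ∈ Ioo (0 : ℝ) 1) (hε0 : Tendsto ε atTop (𝓝 0)) {u : L2 a b}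
    {U : ℕ → L2 a b} (hU : Tendsto U atTop (𝓝 u)) :
    extendTop E₀ u ≤ liminf (fun k => extendTop (E (ε k)) (U k)) atTop := by
  by_contra! hlt
  obtain ⟨c, hliminf, hc⟩ := EReal.lt_iff_exists_real_btwn.1 hlt
  obtain ⟨τ, hτ, hτc⟩ := extraction_of_frequently_atTop
    (frequently_lt_of_liminf_lt (by isBoundedDefault) hliminf)
  obtain ⟨σ, W, w, hσ, hWU, hUw, hWw, -⟩ := hcompact (ε ∘ τ) (fun k => hε _)
    (hε0.comp hτ.tendsto_atTop) (U ∘ τ) c hτc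
  have hτσ : Tendsto (τ ∘ σ) atTop atTop := hτ.tendsto_atTop.comp hσ.tendsto_atTop
  obtain rfl : u = w.toL2 := tendsto_nhds_unique (hU.comp hτσ) hUw
  have hWc (j : ℕ) : E (ε (τ (σ j))) (W j) < c := by
    rw [← EReal.coe_lt_coe_iff, ← extendTop_toL2, hWU]
    exact hτc (σ j)
  have hw : E₀ w ≤ c := hlsc (ε ∘ τ ∘ σ) W w c
    (tendsto_nhdsWithin_iff.2 ⟨hε0.comp hτσ, Eventually.of_forall fun j => (hε _).1⟩) hWw
    fun j => (hWc j).le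
  rw [extendTop_toL2, EReal.coe_lt_coe_iff] at hc
  exact hc.not_ge hw

theorem limsup_extendTop_le {E : ℕ → H1 a b → ℝ} {E₀ : H1 a b → ℝ}
    (hE : ∀ w, Tendsto (fun k => E k w) atTop (𝓝 (E₀ w))) (u : L2 a b) :
    limsup (fun k => extendTop (E k) u) atTop ≤ extendTop E₀ u := by
  by_cases hu : ∃ w : H1 a b, w.toL2 = u
  · obtain ⟨w, rfl⟩ := hu
    simp only [extendTop_toL2]
    exact ((continuous_coe_real_ereal.tendsto _).comp (hE w)).limsup_eq.le
  · rw [extendTop, dif_neg hu]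
    exact le_top

theorem gammaConverges_extendTop {E : ℝ → H1 a b → ℝ} {E₀ : H1 a b → ℝ}
    (hcompact : EnergyCompact fun ε => extendTop (E ε))
    (hlsc : ∀ (ε : ℕ → ℝ) (W : ℕ → H1 a b) (w : H1 a b) (c : ℝ), Tendsto ε atTop (𝓝[>] 0) →
      TendstoWeakly W atTop w → (∀ k, E (ε k) (W k) ≤ c) → E₀ w ≤ c)
    (hlim : ∀ w, Tendsto (fun ε => E ε w) (𝓝[>] 0) (𝓝 (E₀ w))) :
    GammaConverges (fun ε => extendTop (E ε)) (extendTop E₀) := fun _ hε hε0 =>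
  ⟨fun _ _ hU => extendTop_le_liminf hcompact hlsc hε hε0 hU, fun u => ⟨fun _ => u,
    tendsto_const_nhds, limsup_extendTop_le (fun w => (hlim w).comp (tendsto_nhdsWithin_iff.2
      ⟨hε0, Eventually.of_forall fun k => (hε k).1⟩)) u⟩⟩

end ExtendTop

/-! ### The diffuse and sharp energies -/

section Energies

variable {a b a₁ b₁ α β γ κ ε : ℝ}

theorem diffuseEnergy_eq (hab : a < b) (h₁ : a₁ < b₁) (hε : 0 < ε) (h q : L2 a b)
    (g u : H1 a b) :
    diffuseEnergy a₁ b₁ α β γ κ h q g ε u = bulkEnergy α β γ h q (phaseField a₁ b₁ ε) u +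
      ∫ x in Ioo a b, surfaceDensity κ g u x * |deriv (phaseField a₁ b₁ ε) x| := by
  rw [bulkEnergy, ← integral_add ((isPhase_phaseField h₁ ε).integrable_bulkEnergy h q u)
    (integrable_surfaceDensity_mul hab (integrable_abs_deriv_phaseField h₁ hε).integrableOn g u)]
  refine integral_congr_ae ?_
  filter_upwards [u.ae_eq_pointValue hab, g.ae_eq_pointValue hab] with x hu hg
  rw [surfaceDensity, ← hu, ← hg]
  rfl

theorem sharpEnergy_eq (h q : L2 a b) (g u : H1 a b) :
    sharpEnergy a₁ b₁ α β γ κ h q g u = bulkEnergy α β γ h q ((Ioo a₁ b₁).indicator 1) u +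
      (surfaceDensity κ g u a₁ + surfaceDensity κ g u b₁) := by
  rw [sharpEnergy, add_assoc, bulkEnergy]
  congr 1
  refine integral_congr_ae ?_
  filter_upwards [ae_sharp_eq_blend (a := a) (b := b) (a₁ := a₁) (b₁ := b₁) (fun _ => α) fun _ => 1,
    ae_sharp_eq_blend (fun _ => β) fun _ => γ, ae_sharp_eq_blend h q] with x hD hc hf
  rw [hD, hc, hf]

theorem le_diffuseEnergy (hab : a < b) (h₁ : a₁ < b₁) (hε : 0 < ε) (hκ : 0 ≤ κ) {m : ℝ}
    (hα : m ≤ α) (h1 : m ≤ 1) (hβ : m ≤ β) (hγ : m ≤ γ) (h q : L2 a b) (g u : H1 a b) :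
    1 / 2 * m * ‖u‖ ^ 2 - ((∫ x in Ioo a b, (|h x| + |q x|)) * embeddingConst a b +
      embeddingConst a b * ‖g‖ * embeddingConst a b * 2) * ‖u‖ ≤
      diffuseEnergy a₁ b₁ α β γ κ h q g ε u := by
  have hbulk := (isPhase_phaseField h₁ ε).le_bulkEnergy hab hα h1 hβ hγ h q u
  have hsurface := le_setIntegral_surfaceDensity_mul hab hκ
    (integrable_abs_deriv_phaseField h₁ hε).integrableOn (fun x => abs_nonneg _) g u
  have hC : 0 ≤ embeddingConst a b := embeddingConst_nonneg
  have hmass := mul_le_mul_of_nonneg_left (setIntegral_abs_deriv_phaseField_le h₁ hε (Ioo a b))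
    (mul_nonneg (mul_nonneg hC (norm_nonneg g)) (mul_nonneg hC (norm_nonneg u)))
  rw [diffuseEnergy_eq hab h₁ hε]
  linarith

theorem le_of_mul_sq_sub_mul_lt {m K M r : ℝ} (hm : 0 < m) (hK : 0 ≤ K)
    (hr : m * r ^ 2 - K * r < M) : r ≤ (K + |M|) / m + 1 := by
  by_contra! hlt
  have h1 : 1 < r := lt_of_le_of_lt (le_add_of_nonneg_left (by positivity)) hlt
  have h2 : K + |M| < m * r := by
    rw [← div_lt_iff₀' hm]
    linarith
  nlinarith [le_abs_self M, abs_nonneg M]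

theorem exists_norm_le_of_diffuseEnergy_lt (hab : a < b) (h₁ : a₁ < b₁) (hα : 0 < α) (hβ : 0 < β)
    (hγ : 0 < γ) (hκ : 0 ≤ κ) (h q : L2 a b) (g : H1 a b) (M : ℝ) :
    ∃ B, ∀ ε ∈ Ioo (0 : ℝ) 1, ∀ u : H1 a b,
      diffuseEnergy a₁ b₁ α β γ κ h q g ε u < M → ‖u‖ ≤ B := by
  obtain ⟨m, hm, hmα, hm1, hmβ, hmγ⟩ : ∃ m : ℝ, 0 < m ∧ m ≤ α ∧ m ≤ 1 ∧ m ≤ β ∧ m ≤ γ :=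
    ⟨min (min α 1) (min β γ), by positivity, by simp, by simp, by simp, by simp⟩
  have hC : 0 ≤ embeddingConst a b := embeddingConst_nonneg
  exact ⟨_, fun ε hε u hu => le_of_mul_sq_sub_mul_lt (half_pos hm |>.trans_eq (by ring))
    (by positivity) ((le_diffuseEnergy hab h₁ hε.1 hκ hmα hm1 hmβ hmγ h q g u).trans_lt hu)⟩

theorem TendstoWeakly.sharpEnergy_le (ha : a < a₁) (h₁ : a₁ < b₁) (hb : b₁ < b) (hα : 0 ≤ α)
    {h q : L2 a b} {g : H1 a b} {ε : ℕ → ℝ} (hε : Tendsto ε atTop (𝓝[>] 0)) {W : ℕ → H1 a b}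
    {w : H1 a b} (hW : TendstoWeakly W atTop w) {c : ℝ}
    (hc : ∀ k, diffuseEnergy a₁ b₁ α β γ κ h q g (ε k) (W k) ≤ c) :
    sharpEnergy a₁ b₁ α β γ κ h q g w ≤ c := by
  have hab : a < b := ha.trans (h₁.trans hb)
  have hsurface := hW.tendsto_integral_surfaceDensity (κ := κ) ha h₁ hb hε g
  rw [sharpEnergy_eq, ← le_sub_iff_add_le]
  refine hW.bulkEnergy_le hab hα (fun k => isPhase_phaseField h₁ (ε k))
    (isPhase_indicator measurableSet_Ioo) (ae_restrict_of_ae (ae_tendsto_phaseField h₁ hε))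
    (hsurface.const_sub c) ?_
  filter_upwards [hε.eventually self_mem_nhdsWithin] with k hk
  rw [le_sub_iff_add_le, ← diffuseEnergy_eq hab h₁ hk]
  exact hc k

theorem tendsto_diffuseEnergy (ha : a < a₁) (h₁ : a₁ < b₁) (hb : b₁ < b) (h q : L2 a b)
    (g u : H1 a b) :
    Tendsto (fun ε => diffuseEnergy a₁ b₁ α β γ κ h q g ε u) (𝓝[>] 0)
      (𝓝 (sharpEnergy a₁ b₁ α β γ κ h q g u)) := by
  have hab : a < b := ha.trans (h₁.trans hb)
  refine tendsto_of_seq_tendsto fun ε hε => ?_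
  rw [sharpEnergy_eq]
  refine ((tendsto_bulkEnergy hab (fun k => isPhase_phaseField h₁ (ε k))
    (isPhase_indicator measurableSet_Ioo) (ae_restrict_of_ae (ae_tendsto_phaseField h₁ hε)) h q
    u).add ((tendstoWeakly_const u atTop).tendsto_integral_surfaceDensity ha h₁ hb hε g)).congr' ?_
  filter_upwards [hε.eventually self_mem_nhdsWithin] with k hk
  exact (diffuseEnergy_eq hab h₁ hk h q g u).symm

end Energies

end DiffuseDomain

end

theorem mainTheorem3 (a a₁ b₁ b α β γ κ : ℝ)
    (haa₁ : a < a₁) (ha₁b₁ : a₁ < b₁) (hb₁b : b₁ < b)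
    (hα : 0 < α) (hβ : 0 < β) (hγ : 0 < γ) (hκ : 0 ≤ κ)
    (h q : DiffuseDomain.L2 a b) (g : DiffuseDomain.H1 a b) :
    DiffuseDomain.EnergyCompact
      (fun ε => DiffuseDomain.extendTop
        (DiffuseDomain.diffuseEnergy a₁ b₁ α β γ κ h q g ε)) ∧
    DiffuseDomain.GammaConverges
      (fun ε => DiffuseDomain.extendTop
        (DiffuseDomain.diffuseEnergy a₁ b₁ α β γ κ h q g ε))
      (DiffuseDomain.extendTop
        (DiffuseDomain.sharpEnergy a₁ b₁ α β γ κ h q g)) := by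
  have hab : a < b := haa₁.trans (ha₁b₁.trans hb₁b)
  have hcompact := DiffuseDomain.energyCompact_extendTop hab
    (DiffuseDomain.exists_norm_le_of_diffuseEnergy_lt hab ha₁b₁ hα hβ hγ hκ h q g)
  exact ⟨hcompact, DiffuseDomain.gammaConverges_extendTop hcompact
    (fun _ _ _ _ hε hW hc => hW.sharpEnergy_le haa₁ ha₁b₁ hb₁b hα.le hε hc)
    (DiffuseDomain.tendsto_diffuseEnergy haa₁ ha₁b₁ hb₁b h q g)⟩
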